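/- **Correlation clustering.** The input is a graph $G=(V,E^+)$ with $V=\{0,\dots,n-1\}$, $n\ge 2$, and $m=|E^+|$; distinct nodes are similar if they are adjacent and dissimilar otherwise. The cost of a partition of $V$ into clusters is its number of disagreements, i.e. the number of pairs of similar nodes in different clusters plus the number of pairs of dissimilar nodes in the same cluster. Let $\mathrm{OPT}(G)$ be the minimum cost over all partitions. **MPC model.** There are $M$ machines with $S$ words of memory each, where a word is one of $(n+1)^2$ values and so has $O(\log n)$ bits; the total memory is $M\cdot S$ words. Each node is placed, together with all its incident edges (a record of $1+\deg(v)$ words), on one machine, its host; the placement is arbitrary except that the input fills at most half of the memory of each machine (an admissible placement). The computation proceeds in synchronous rounds. In each round every machine draws fresh private randomness, performs an arbitrary local computation on the contents of its memory, keeps some words and sends messages to any machines. A machine sends at most $S$ words in a round, and the words that it keeps and those that it receives together number at most $S$; these bounds hold for all random choices. After the last round the host of each node outputs the label of the node's cluster. **Theorem.** There are absolute constants $T$ (a number of rounds) and $k$, and for every $c\in\mathbb N$ a constant $C=C(c)$, such that for all $0<\varepsilon\le 1$ and all $n\ge2$ and $m$ there is a randomized $T$-round MPC algorithm on $M$ machines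 with $S$ words of memory each, where $$S\le C\cdot\frac n\varepsilon\cdot(\log n)^k,\qquad M\cdot S\le C\cdot\Bigl(m+\frac n\varepsilon\Bigr)\cdot(\log n)^k,$$ for which the following holds. For every graph $G$ with $n$ nodes and $m$ edges there is an admissible placement, and for every admissible placement the algorithm obeys the memory bounds and outputs a clustering whose cost $X$ satisfies $$\mathbb E[X]\le(3+\varepsilon)\,\mathrm{OPT}(G)\qquad\text{and}\qquad \Pr\bigl[X\le(3+\varepsilon)\,\mathrm{OPT}(G)\bigr]\ge 1-n^{-c}.$$ In other words, there is an $O(1)$-round linear-space MPC algorithm with $\widetilde O(n/\varepsilon)$ words of memory per machine and $\widetilde O(m+n/\varepsilon)$ words of total memory that computes a $(3+\varepsilon)$-approximate correlation clustering in expectation and with high probability. -/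

import Mathlib

open scoped BigOperators

/-! ### Correlation clustering

The complete signed graph is identified with the simple graph `G` of its positive edges: two distinct
nodes are similar if they are adjacent in `G`, and dissimilar otherwise. A clustering is a partition
of the nodes, i.e. a `Setoid`. -/

namespace CorrClust

open Classical in
/-- The number of disagreements of the clustering `P`: the number of unordered pairs of distinct nodes
(listed as `u < v`) that are similar but separated, or dissimilar but in the same cluster. -/
noncomputable def cost {n : ℕ} (G : SimpleGraph (Fin n)) (P : Setoid (Fin n)) : ℕ :=
  (Finset.univ.filter fun p : Fin n × Fin n =>
    p.1 < p.2 ∧ ((G.Adj p.1 p.2 ∧ ¬ P p.1 p.2) ∨ (¬ G.Adj p.1 p.2 ∧ P p.1 p.2))).card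

/-- The minimum number of disagreements over all clusterings (a minimum of natural numbers over a
nonempty family). -/
noncomputable def opt {n : ℕ} (G : SimpleGraph (Fin n)) : ℕ :=
  ⨅ P : Setoid (Fin n), cost G P

end CorrClust

/-! ### The massively parallel computation model -/

namespace MPC

/-- A machine word: one of `(n + 1) ^ 2` values, hence `O(log n)` bits. It can hold the identifier of a
node or of an edge of an `n`-node graph. -/
abbrev Word (n : ℕ) : Type := Fin (n + 1) × Fin (n + 1)

/-- The contents of the memory of one of `M` machines at the beginning of a round: the words that it
has kept, and the words that it has just received, listed by sender. -/
structure Memory (n M : ℕ) where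
  kept : List (Word n)
  inbox : Fin M → List (Word n)

/-- The number of words in memory. -/
def Memory.size {n M : ℕ} (x : Memory n M) : ℕ :=
  x.kept.length + ∑ j, (x.inbox j).length

/-- What a machine produces in a round: the words it keeps and the message to each machine. -/
structure Action (n M : ℕ) where
  keep : List (Word n)
  send : Fin M → List (Word n)

/-- The number of words sent; a word sent to several machines is counted once for each of them. -/
def Action.sent {n M : ℕ} (a : Action n M) : ℕ := ∑ j, (a.send j).length

/-- A randomized algorithm for `M` machines and `T` synchronous rounds on `n`-node graphs.
In each round each machine draws a fresh private seed, uniformly from a finite set and independently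
of everything else, and performs an arbitrary local computation on its memory and this seed (a seed is
available later only as far as it is written into kept words or messages).
After the last round, each machine can compute a cluster label for each node that it hosts. -/
structure Algorithm (n M T : ℕ) where
  seeds : ℕ
  seeds_pos : 0 < seeds
  step : Fin T → Fin M → Fin seeds → Memory n M → Action n M
  label : Fin M → Memory n M → Fin n → Fin n

open Classical in
/-- The input record of a node `v`: its identifier, written `(v, v)`, and its incident edges `(v, u)`. -/
noncomputable def nodeRecord {n : ℕ} (G : SimpleGraph (Fin n)) (v : Fin n) : List (Word n) :=
  (v.castSucc, v.castSucc) ::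
    ((List.finRange n).filter fun u => G.Adj v u).map fun u => (v.castSucc, u.castSucc)

/-- The part of the input on machine `i`, where `place v` is the machine on which the node `v` and all
its incident edges are placed. -/
noncomputable def inputWords {n M : ℕ} (G : SimpleGraph (Fin n)) (place : Fin n → Fin M)
    (i : Fin M) : List (Word n) :=
  (List.finRange n).flatMap fun v => if place v = i then nodeRecord G v else []

/-- A placement of the input is admissible for machines with `S` words of memory if the input occupies
at most half of the memory of each machine. -/
def Admissible {n M : ℕ} (S : ℕ) (G : SimpleGraph (Fin n)) (place : Fin n → Fin M) : Prop :=
  ∀ i, 2 * (inputWords G place i).length ≤ S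

namespace Algorithm

variable {n M T : ℕ}

/-- The sample space, with the uniform distribution: one seed per round and machine. -/
abbrev Seeds (A : Algorithm n M T) : Type := Fin T → Fin M → Fin A.seeds

/-- The memories of all machines after the first `t` rounds (`t ≤ T`). -/
noncomputable def run (A : Algorithm n M T) (G : SimpleGraph (Fin n)) (place : Fin n → Fin M)
    (ω : A.Seeds) : ℕ → Fin M → Memory n M
  | 0 => fun i => ⟨inputWords G place i, fun _ => []⟩
  | t + 1 =>
    if h : t < T then
      fun i =>
        ⟨(A.step ⟨t, h⟩ i (ω ⟨t, h⟩ i) (run A G place ω t i)).keep,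
          fun j => (A.step ⟨t, h⟩ j (ω ⟨t, h⟩ j) (run A G place ω t j)).send i⟩
    else run A G place ω t

/-- The action of machine `i` in round `t` (the rounds are numbered from `0`). -/
noncomputable def action (A : Algorithm n M T) (G : SimpleGraph (Fin n)) (place : Fin n → Fin M)
    (ω : A.Seeds) (t : Fin T) (i : Fin M) : Action n M :=
  A.step t i (ω t i) (A.run G place ω t i)

/-- `S` words of memory per machine suffice: whatever the random choices, each machine holds at most
`S` words (kept and received) at all times, and sends at most `S` words in each round. -/
def UsesSpace (A : Algorithm n M T) (S : ℕ) (G : SimpleGraph (Fin n))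
    (place : Fin n → Fin M) : Prop :=
  ∀ ω : A.Seeds,
    (∀ t ≤ T, ∀ i, (A.run G place ω t i).size ≤ S) ∧
    (∀ t i, (A.action G place ω t i).sent ≤ S)

/-- The clustering that the algorithm computes: two nodes are in the same cluster if their hosts give
them the same label. -/
noncomputable def clustering (A : Algorithm n M T) (G : SimpleGraph (Fin n))
    (place : Fin n → Fin M) (ω : A.Seeds) : Setoid (Fin n) :=
  Setoid.ker fun v => A.label (place v) (A.run G place ω T (place v)) v

/-- The probability of an event under the uniform distribution on the seeds. -/
noncomputable def prob (A : Algorithm n M T) (E : Set A.Seeds) : ℝ :=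
  (E.ncard : ℝ) / (Fintype.card A.Seeds : ℝ)

/-- The expectation of a random variable under the uniform distribution on the seeds. -/
noncomputable def expectation (A : Algorithm n M T) (X : A.Seeds → ℝ) : ℝ :=
  (∑ ω, X ω) / (Fintype.card A.Seeds : ℝ)

end Algorithm

end MPC

namespace CorrClust

open Finset

section Clusters

open Classical

variable {n : ℕ}

/-- The closed neighbourhood of a node. -/
noncomputable def nbhd (G : SimpleGraph (Fin n)) (v : Fin n) : Finset (Fin n) :=
  univ.filter fun u => u = v ∨ G.Adj v u

/-- The open neighbourhood of a node. -/
noncomputable def nbrs (G : SimpleGraph (Fin n)) (v : Fin n) : Finset (Fin n) :=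
  univ.filter fun u => G.Adj v u

/-- The cluster of a node. -/
noncomputable def cl (P : Setoid (Fin n)) (v : Fin n) : Finset (Fin n) :=
  univ.filter fun u => P v u

/-- The clusters of a clustering. -/
noncomputable def clusters (P : Setoid (Fin n)) : Finset (Finset (Fin n)) :=
  univ.image (cl P)

/-- The number of disagreements at `v` if `C` is the cluster of `v`. -/
noncomputable def dis (G : SimpleGraph (Fin n)) (v : Fin n) (C : Finset (Fin n)) : ℕ :=
  (symmDiff (nbhd G v) C).card

/-- The sum of the disagreements at the nodes of the cluster `C`. -/
noncomputable def contr (G : SimpleGraph (Fin n)) (C : Finset (Fin n)) : ℕ :=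
  ∑ v ∈ C, dis G v C

@[simp] lemma mem_nbhd {G : SimpleGraph (Fin n)} {u v : Fin n} :
    u ∈ nbhd G v ↔ u = v ∨ G.Adj v u := by simp [nbhd]

@[simp] lemma mem_nbrs {G : SimpleGraph (Fin n)} {u v : Fin n} :
    u ∈ nbrs G v ↔ G.Adj v u := by simp [nbrs]

@[simp] lemma mem_cl {P : Setoid (Fin n)} {u v : Fin n} : u ∈ cl P v ↔ P v u := by simp [cl]

lemma self_mem_cl (P : Setoid (Fin n)) (v : Fin n) : v ∈ cl P v := by simp

lemma cl_eq_of_mem {P : Setoid (Fin n)} {u v : Fin n} (h : u ∈ cl P v) : cl P u = cl P v := by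
  rw [mem_cl] at h
  ext x
  simp only [mem_cl]
  exact ⟨fun hx => P.trans h hx, fun hx => P.trans (P.symm h) hx⟩

lemma cl_mem_clusters (P : Setoid (Fin n)) (v : Fin n) : cl P v ∈ clusters P :=
  mem_image_of_mem _ (mem_univ v)

lemma eq_cl_of_mem {P : Setoid (Fin n)} {C : Finset (Fin n)} (hC : C ∈ clusters P) {v : Fin n}
    (hv : v ∈ C) : C = cl P v := by
  obtain ⟨u, -, rfl⟩ := mem_image.1 hC
  exact (cl_eq_of_mem hv).symm

lemma nonempty_of_mem_clusters {P : Setoid (Fin n)} {C : Finset (Fin n)} (hC : C ∈ clusters P) :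
    C.Nonempty := by
  obtain ⟨u, -, rfl⟩ := mem_image.1 hC
  exact ⟨u, self_mem_cl P u⟩

lemma card_nbhd (G : SimpleGraph (Fin n)) (v : Fin n) : (nbhd G v).card = (nbrs G v).card + 1 := by
  have : nbhd G v = insert v (nbrs G v) := by ext; simp
  rw [this, card_insert_of_notMem (by simp)]

lemma card_nbrs_lt (G : SimpleGraph (Fin n)) (v : Fin n) : (nbrs G v).card < n := by
  have := card_le_univ (nbhd G v)
  rw [card_nbhd, Fintype.card_fin] at this
  exact this

/-- A double sum over some clusters and their nodes is a sum over nodes. -/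
lemma sum_clusters {P : Setoid (Fin n)} {𝒜 : Finset (Finset (Fin n))} (h𝒜 : 𝒜 ⊆ clusters P)
    (g : Finset (Fin n) → Fin n → ℕ) :
    ∑ C ∈ 𝒜, ∑ v ∈ C, g C v = ∑ v with cl P v ∈ 𝒜, g (cl P v) v := by
  rw [← sum_fiberwise_of_maps_to (s := univ.filter fun v => cl P v ∈ 𝒜) (t := 𝒜) (g := cl P)
    (fun v hv => (mem_filter.1 hv).2)]
  refine sum_congr rfl fun C hC => ?_
  have : (univ.filter fun v => cl P v ∈ 𝒜).filter (fun v => cl P v = C) = C := by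
    ext v
    simp only [mem_filter, mem_univ, true_and]
    constructor
    · rintro ⟨-, rfl⟩; exact self_mem_cl P v
    · intro hv
      have := eq_cl_of_mem (h𝒜 hC) hv
      exact ⟨this ▸ hC, this.symm⟩
  rw [this]
  exact sum_congr rfl fun v hv => by rw [← eq_cl_of_mem (h𝒜 hC) hv]

lemma sum_contr_clusters (G : SimpleGraph (Fin n)) (P : Setoid (Fin n)) :
    ∑ C ∈ clusters P, contr G C = ∑ v, dis G v (cl P v) := by
  simp only [contr]
  rw [sum_clusters subset_rfl (fun C v => dis G v C)]
  simp [cl_mem_clusters]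

/-- Every disagreement is seen by both of its nodes. -/
lemma sum_dis_eq (G : SimpleGraph (Fin n)) (P : Setoid (Fin n)) :
    ∑ v, dis G v (cl P v) = 2 * cost G P := by
  set B : Fin n → Fin n → Prop := fun v u =>
    (G.Adj v u ∧ ¬ P v u) ∨ (¬ G.Adj v u ∧ P v u) with hB
  have hsymm : ∀ v u, B v u ↔ B u v := fun v u => by
    simp only [hB, G.adj_comm v u]
    rw [show P v u ↔ P u v from ⟨fun h => P.symm h, fun h => P.symm h⟩]
  have h1 : ∀ v, dis G v (cl P v) =
      (univ.filter fun u => v < u ∧ B v u).card + (univ.filter fun u => u < v ∧ B v u).card := by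
    intro v
    rw [← card_union_of_disjoint, dis]
    · congr 1
      ext u
      simp only [mem_symmDiff, mem_nbhd, mem_cl, mem_union, mem_filter, mem_univ, true_and, hB]
      rcases lt_trichotomy v u with h | h | h
      · have h' := h.ne'; have h'' := h.not_gt; simp [h, h', h'']; tauto
      · subst h; simp
      · have h' := h.ne; have h'' := h.not_gt; simp [h, h', h'']; tauto
    · rw [disjoint_filter]; rintro u - ⟨h, -⟩ ⟨h', -⟩; exact absurd h h'.not_gt
  have h2 : ∑ v, (univ.filter fun u => v < u ∧ B v u).card = cost G P := by
    rw [cost, card_filter, ← univ_product_univ, sum_product]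
    refine sum_congr rfl fun v _ => ?_
    rw [card_filter]
  have h3 : ∑ v, (univ.filter fun u => u < v ∧ B v u).card = cost G P := by
    rw [cost, card_filter, ← univ_product_univ, sum_product_right]
    refine sum_congr rfl fun v _ => ?_
    rw [card_filter]
    refine sum_congr rfl fun u _ => ?_
    simp only [hsymm v u]
    rfl
  simp only [h1, sum_add_distrib, h2, h3]
  ring

lemma exists_cost_eq_opt (G : SimpleGraph (Fin n)) : ∃ P, cost G P = opt G :=
  ciInf_mem (fun P : Setoid (Fin n) => cost G P)

lemma cost_le (G : SimpleGraph (Fin n)) (P : Setoid (Fin n)) : cost G P ≤ n ^ 2 := by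
  refine (card_le_univ _).trans ?_
  simp [sq]

/-! Comparison of two clusterings outside their common clusters. -/

lemma cl_mem_sdiff {P Q : Setoid (Fin n)} (v : Fin n) :
    cl P v ∈ clusters P \ clusters Q ↔ cl P v ≠ cl Q v := by
  rw [mem_sdiff]
  constructor
  · rintro ⟨-, h⟩ h'
    exact h (h' ▸ cl_mem_clusters Q v)
  · exact fun h => ⟨cl_mem_clusters P v, fun h' => h (eq_cl_of_mem h' (self_mem_cl P v))⟩

lemma sum_card_sdiff (P Q : Setoid (Fin n)) :
    ∑ C ∈ clusters P \ clusters Q, C.card = (univ.filter fun v => cl P v ≠ cl Q v).card := by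
  have := sum_clusters (sdiff_subset (s := clusters P) (t := clusters Q)) (fun _ _ => 1)
  simp only [cl_mem_sdiff] at this
  simpa using this

lemma sum_contr_sdiff (G : SimpleGraph (Fin n)) (P Q : Setoid (Fin n)) :
    ∑ C ∈ clusters P \ clusters Q, contr G C =
      ∑ v with cl P v ≠ cl Q v, dis G v (cl P v) := by
  have := sum_clusters (sdiff_subset (s := clusters P) (t := clusters Q)) (fun C v => dis G v C)
  simp only [cl_mem_sdiff] at this
  simpa [contr] using this

lemma sum_card_sdiff_comm (P Q : Setoid (Fin n)) :
    ∑ C ∈ clusters P \ clusters Q, C.card = ∑ C ∈ clusters Q \ clusters P, C.card := by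
  simp only [sum_card_sdiff, ne_comm]

/-- A node without disagreements in either of two clusterings is in a common cluster. -/
lemma sum_card_sdiff_le (G : SimpleGraph (Fin n)) (P Q : Setoid (Fin n)) :
    ∑ C ∈ clusters P \ clusters Q, C.card ≤
      ∑ C ∈ clusters P \ clusters Q, contr G C + ∑ C ∈ clusters Q \ clusters P, contr G C := by
  rw [sum_card_sdiff, sum_contr_sdiff, sum_contr_sdiff, card_eq_sum_ones]
  simp only [ne_comm (a := cl Q _)]
  rw [← sum_add_distrib]
  refine sum_le_sum fun v hv => ?_
  have hv := (mem_filter.1 hv).2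
  by_contra h
  have h1 : dis G v (cl P v) = 0 := by omega
  have h2 : dis G v (cl Q v) = 0 := by omega
  simp only [dis, card_eq_zero, symmDiff_eq_bot, ← bot_eq_empty] at h1 h2
  exact hv (h1.symm.trans h2)

lemma two_mul_cost_eq (G : SimpleGraph (Fin n)) (P Q : Setoid (Fin n)) :
    2 * cost G P = ∑ C ∈ clusters P ∩ clusters Q, contr G C +
      ∑ C ∈ clusters P \ clusters Q, contr G C := by
  rw [← sum_dis_eq, ← sum_contr_clusters, sum_inter_add_sum_sdiff]

/-- `e` estimates the disagreements of each potential cluster, up to a ninth of their number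
plus the number of nodes. -/
def GoodEstimate (G : SimpleGraph (Fin n)) (e : Finset (Fin n) → ℝ) : Prop :=
  ∀ C : Finset (Fin n), C.Nonempty → |e C - contr G C| ≤ 1 / 9 * (contr G C + C.card)

lemma cost_le_of_minimizer {G : SimpleGraph (Fin n)} {e : Finset (Fin n) → ℝ}
    (he : GoodEstimate G e) {P : Setoid (Fin n)}
    (hP : ∀ Q, ∑ C ∈ clusters P, e C ≤ ∑ C ∈ clusters Q, e C) :
    cost G P ≤ 2 * opt G := by
  obtain ⟨Q, hQ⟩ := exists_cost_eq_opt G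
  rw [← hQ]
  have h1 := hP Q
  rw [← sum_inter_add_sum_sdiff (clusters P) (clusters Q),
    ← sum_inter_add_sum_sdiff (clusters Q) (clusters P), inter_comm (clusters Q)] at h1
  have h2 : ∑ C ∈ clusters P \ clusters Q, ((contr G C : ℝ) - 1 / 9 * (contr G C + C.card)) ≤
      ∑ C ∈ clusters P \ clusters Q, e C := by
    refine sum_le_sum fun C hC => ?_
    have := (abs_le.1 (he C (nonempty_of_mem_clusters (mem_sdiff.1 hC).1))).1
    linarith
  have h3 : ∑ C ∈ clusters Q \ clusters P, e C ≤
      ∑ C ∈ clusters Q \ clusters P, ((contr G C : ℝ) + 1 / 9 * (contr G C + C.card)) := by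
    refine sum_le_sum fun C hC => ?_
    have := (abs_le.1 (he C (nonempty_of_mem_clusters (mem_sdiff.1 hC).1))).2
    linarith
  simp only [sum_sub_distrib, sum_add_distrib, ← mul_sum] at h2 h3
  have h4 : (∑ C ∈ clusters P \ clusters Q, (C.card : ℝ)) ≤
      ∑ C ∈ clusters P \ clusters Q, (contr G C : ℝ) +
        ∑ C ∈ clusters Q \ clusters P, (contr G C : ℝ) := by
    exact_mod_cast sum_card_sdiff_le G P Q
  have h5 : (∑ C ∈ clusters P \ clusters Q, (C.card : ℝ)) =
      ∑ C ∈ clusters Q \ clusters P, (C.card : ℝ) := by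
    exact_mod_cast sum_card_sdiff_comm P Q
  have h6 : (∑ C ∈ clusters P \ clusters Q, (contr G C : ℝ)) ≤
      2 * ∑ C ∈ clusters Q \ clusters P, (contr G C : ℝ) := by linarith
  have h6' : (∑ C ∈ clusters P \ clusters Q, contr G C) ≤
      2 * ∑ C ∈ clusters Q \ clusters P, contr G C := by exact_mod_cast h6
  have h7 := two_mul_cost_eq G P Q
  have h8 := two_mul_cost_eq G Q P
  rw [inter_comm] at h8
  omega

lemma cost_le_of_nonpos {G : SimpleGraph (Fin n)} {e : Finset (Fin n) → ℝ}
    (he : GoodEstimate G e) {P : Setoid (Fin n)} (hP : ∀ v, e (cl P v) ≤ 0) :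
    cost G P ≤ opt G := by
  obtain ⟨Q, hQ⟩ := exists_cost_eq_opt G
  rw [← hQ]
  have h2 : 8 * ∑ C ∈ clusters P \ clusters Q, contr G C ≤
      ∑ C ∈ clusters P \ clusters Q, C.card := by
    rw [mul_sum]
    refine sum_le_sum fun C hC => ?_
    have hC := (mem_sdiff.1 hC).1
    have h := (abs_le.1 (he C (nonempty_of_mem_clusters hC))).1
    obtain ⟨u, -, rfl⟩ := mem_image.1 hC
    have := hP u
    have : (8 * contr G (cl P u) : ℝ) ≤ (cl P u).card := by linarith
    exact_mod_cast this
  have h4 := sum_card_sdiff_le G P Q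
  have h7 := two_mul_cost_eq G P Q
  have h8 := two_mul_cost_eq G Q P
  rw [inter_comm] at h8
  omega

/-! The rule by which a clustering is chosen. -/

instance : Finite (Setoid (Fin n)) :=
  Finite.of_injective (fun P : Setoid (Fin n) => fun u v => P u v) fun _ _ h =>
    Setoid.ext fun u v => iff_of_eq (congrFun (congrFun h u) v)

lemma exists_minimizer (e : Finset (Fin n) → ℝ) :
    ∃ P : Setoid (Fin n), ∀ Q, ∑ C ∈ clusters P, e C ≤ ∑ C ∈ clusters Q, e C :=
  Finite.exists_min fun P : Setoid (Fin n) => ∑ C ∈ clusters P, e C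

/-- The partition `ker l` if the estimate sees no disagreement in it, and otherwise a clustering
with the fewest estimated disagreements. -/
noncomputable def choosePartition (e : Finset (Fin n) → ℝ) (l : Fin n → Fin n) :
    Setoid (Fin n) :=
  if ∀ v, e (cl (Setoid.ker l) v) ≤ 0 then Setoid.ker l else (exists_minimizer e).choose

lemma cost_choosePartition_le {G : SimpleGraph (Fin n)} {e : Finset (Fin n) → ℝ}
    (he : GoodEstimate G e) (l : Fin n → Fin n) :
    cost G (choosePartition e l) ≤ 2 * opt G := by
  rw [choosePartition]
  split_ifs with h
  · have := cost_le_of_nonpos he h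
    omega
  · exact cost_le_of_minimizer he (exists_minimizer e).choose_spec

/-- The smallest node of the closed neighbourhood. -/
noncomputable def minNbr (G : SimpleGraph (Fin n)) (v : Fin n) : Fin n :=
  (nbhd G v).min' ⟨v, by simp⟩

lemma cl_eq_nbhd_of_cost_eq_zero {G : SimpleGraph (Fin n)} {P : Setoid (Fin n)}
    (hP : cost G P = 0) (v : Fin n) : cl P v = nbhd G v := by
  have h := sum_dis_eq G P
  rw [hP, mul_zero, sum_eq_zero_iff] at h
  have h := h v (mem_univ v)
  simp only [dis, card_eq_zero, symmDiff_eq_bot, ← bot_eq_empty] at h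
  exact h.symm

/-- If some clustering is perfect, then it is found with certainty. -/
lemma cost_choosePartition_eq_zero {G : SimpleGraph (Fin n)} {e : Finset (Fin n) → ℝ}
    (h0 : opt G = 0) (he : ∀ P : Setoid (Fin n), cost G P = 0 → ∀ v, e (cl P v) ≤ 0) :
    cost G (choosePartition e (minNbr G)) = 0 := by
  obtain ⟨P, hP⟩ := exists_cost_eq_opt G
  rw [h0] at hP
  have hcl := cl_eq_nbhd_of_cost_eq_zero hP
  have hker : Setoid.ker (minNbr G) = P := by
    refine Setoid.ext fun u v => ?_
    rw [Setoid.ker_def]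
    constructor
    · intro h
      have hu : minNbr G u ∈ nbhd G u := min'_mem _ _
      have hv : minNbr G v ∈ nbhd G v := min'_mem _ _
      rw [← hcl, mem_cl] at hu hv
      rw [h] at hu
      exact P.trans hu (P.symm hv)
    · intro h
      have : nbhd G v = nbhd G u := by
        rw [← hcl, ← hcl]
        exact cl_eq_of_mem (by simpa using h)
      simp only [minNbr, this]
  rw [choosePartition, hker, if_pos (he P hP), hP]

end Clusters

end CorrClust

namespace FiniteProb

open Finset

section Deviation

variable {α κ : Type*} [Fintype α] [DecidableEq α] [Fintype κ] [Nonempty κ]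

/-- Exponential moments of a sum of independent variables with values in `[0, w]`. -/
lemma sum_exp_deviation_le {Y : α → κ → ℝ} {w s F : ℝ} (hw : 0 ≤ w) (hY0 : ∀ a k, 0 ≤ Y a k)
    (hYw : ∀ a k, Y a k ≤ w) (hs : |s| * w ≤ 1)
    (hF : ∑ a, (∑ k, Y a k) / Fintype.card κ ≤ F) :
    ∑ ω : α → κ, Real.exp (s * (∑ a, Y a (ω a) - ∑ a, (∑ k, Y a k) / Fintype.card κ)) ≤
      Fintype.card (α → κ) * Real.exp (s ^ 2 * w * F) := by
  set q : ℝ := (Fintype.card κ : ℝ) with hq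
  have hq0 : 0 < q := by rw [hq]; exact_mod_cast Fintype.card_pos
  have hkey : ∀ a, ∑ k, Real.exp (s * (Y a k - (∑ k, Y a k) / q)) ≤
      q * Real.exp (s ^ 2 * w * ((∑ k, Y a k) / q)) := by
    intro a
    set μ := (∑ k, Y a k) / q with hμ
    have h1 : ∀ k, Real.exp (s * (Y a k - μ)) ≤
        (1 + s * Y a k + s ^ 2 * w * Y a k) * Real.exp (-(s * μ)) := by
      intro k
      rw [mul_sub, sub_eq_add_neg, Real.exp_add]
      refine mul_le_mul_of_nonneg_right ?_ (Real.exp_pos _).le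
      have habs : |s * Y a k| ≤ 1 := by
        rw [abs_mul, abs_of_nonneg (hY0 a k)]
        exact (mul_le_mul_of_nonneg_left (hYw a k) (abs_nonneg s)).trans hs
      have h2 := (abs_le.1 (Real.abs_exp_sub_one_sub_id_le habs)).2
      have h3 : (s * Y a k) ^ 2 ≤ s ^ 2 * w * Y a k := by
        rw [mul_pow, mul_assoc]
        refine mul_le_mul_of_nonneg_left ?_ (sq_nonneg s)
        rw [sq]
        exact mul_le_mul_of_nonneg_right (hYw a k) (hY0 a k)
      linarith
    refine (sum_le_sum fun k _ => h1 k).trans ?_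
    rw [← sum_mul, sum_add_distrib, sum_add_distrib, ← mul_sum, ← mul_sum]
    have h4 : ∑ k, Y a k = q * μ := by rw [hμ]; field_simp
    rw [h4]
    simp only [sum_const, card_univ, nsmul_eq_mul, mul_one, ← hq]
    calc (q + s * (q * μ) + s ^ 2 * w * (q * μ)) * Real.exp (-(s * μ))
        = q * ((s * μ + s ^ 2 * w * μ + 1) * Real.exp (-(s * μ))) := by ring
      _ ≤ q * (Real.exp (s * μ + s ^ 2 * w * μ) * Real.exp (-(s * μ))) := by
          gcongr
          exact Real.add_one_le_exp _
      _ = q * Real.exp (s ^ 2 * w * μ) := by rw [← Real.exp_add]; congr 2; ring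
  calc ∑ ω : α → κ, Real.exp (s * (∑ a, Y a (ω a) - ∑ a, (∑ k, Y a k) / q))
      = ∑ ω : α → κ, ∏ a, Real.exp (s * (Y a (ω a) - (∑ k, Y a k) / q)) := by
        refine sum_congr rfl fun ω _ => ?_
        rw [← Real.exp_sum, ← sum_sub_distrib, mul_sum]
    _ = ∏ a, ∑ k, Real.exp (s * (Y a k - (∑ k, Y a k) / q)) := by
        rw [prod_univ_sum, Fintype.piFinset_univ]
    _ ≤ ∏ a : α, q * Real.exp (s ^ 2 * w * ((∑ k, Y a k) / q)) :=
        prod_le_prod (fun a _ => sum_nonneg fun k _ => (Real.exp_pos _).le) fun a _ => hkey a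
    _ = q ^ Fintype.card α * Real.exp (s ^ 2 * w * ∑ a, (∑ k, Y a k) / q) := by
        rw [prod_mul_distrib, prod_const, card_univ, ← Real.exp_sum, mul_sum]
    _ ≤ Fintype.card (α → κ) * Real.exp (s ^ 2 * w * F) := by
        rw [Fintype.card_fun, Nat.cast_pow]
        gcongr

/-- A multiplicative Chernoff bound in counting form. -/
lemma card_deviation_le {Y : α → κ → ℝ} {w τ F : ℝ} (hw : 0 < w) (hY0 : ∀ a k, 0 ≤ Y a k)
    (hYw : ∀ a k, Y a k ≤ w) (hτ0 : 0 < τ) (hτ1 : τ ≤ 1)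
    (hF : ∑ a, (∑ k, Y a k) / Fintype.card κ ≤ F) :
    ((univ.filter fun ω : α → κ =>
        τ * F < |∑ a, Y a (ω a) - ∑ a, (∑ k, Y a k) / Fintype.card κ|).card : ℝ) ≤
      2 * Real.exp (-(τ ^ 2 * F / (4 * w))) * Fintype.card (α → κ) := by
  set μ := ∑ a, (∑ k, Y a k) / (Fintype.card κ : ℝ)
  set s := τ / (2 * w) with hs
  have hs0 : 0 < s := by positivity
  have hsw : |s| * w ≤ 1 := by
    rw [abs_of_pos hs0, hs]; field_simp; linarith
  have h1 := sum_exp_deviation_le hw.le hY0 hYw hsw hF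
  have h2 := sum_exp_deviation_le hw.le hY0 hYw (s := -s) (by rwa [abs_neg]) hF
  rw [neg_sq] at h2
  have h3 : ((univ.filter fun ω : α → κ => τ * F < |∑ a, Y a (ω a) - μ|).card : ℝ) *
      Real.exp (s * (τ * F)) ≤ ∑ ω : α → κ, (Real.exp (s * (∑ a, Y a (ω a) - μ)) +
        Real.exp (-s * (∑ a, Y a (ω a) - μ))) := by
    rw [← nsmul_eq_mul, ← sum_const]
    refine (sum_le_sum fun ω hω => ?_).trans
      (sum_le_sum_of_subset_of_nonneg (filter_subset _ _) fun ω _ _ => by positivity)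
    have hω := (mem_filter.1 hω).2
    rcases lt_abs.1 hω with h | h
    · have : Real.exp (s * (τ * F)) ≤ Real.exp (s * (∑ a, Y a (ω a) - μ)) :=
        Real.exp_le_exp.2 (mul_le_mul_of_nonneg_left h.le hs0.le)
      linarith [Real.exp_pos (-s * (∑ a, Y a (ω a) - μ))]
    · have : Real.exp (s * (τ * F)) ≤ Real.exp (-s * (∑ a, Y a (ω a) - μ)) := by
        rw [neg_mul_comm]
        exact Real.exp_le_exp.2 (mul_le_mul_of_nonneg_left h.le hs0.le)
      linarith [Real.exp_pos (s * (∑ a, Y a (ω a) - μ))]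
  rw [sum_add_distrib] at h3
  have h4 := h3.trans (add_le_add h1 h2)
  rw [← le_div_iff₀ (Real.exp_pos _)] at h4
  refine h4.trans (le_of_eq ?_)
  rw [div_eq_mul_inv, ← Real.exp_neg]
  have : Real.exp (-(τ ^ 2 * F / (4 * w))) =
      Real.exp (s ^ 2 * w * F) * Real.exp (-(s * (τ * F))) := by
    rw [← Real.exp_add, hs]; congr 1; field_simp; ring
  rw [this]; ring

end Deviation

/-- The coordinates picked by an injection are uniformly distributed. -/
lemma card_comp_mul {α ι κ : Type*} [Fintype α] [Fintype ι] [Fintype κ] [DecidableEq α]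
    [DecidableEq ι] {idx : α → ι} (hidx : Function.Injective idx) (E : (α → κ) → Prop)
    [DecidablePred E] :
    (univ.filter fun ω : ι → κ => E (ω ∘ idx)).card * Fintype.card (α → κ) =
      (univ.filter E).card * Fintype.card (ι → κ) := by
  classical
  let e : (ι → κ) ≃ (α → κ) × ({i // i ∉ Set.range idx} → κ) :=
    (Equiv.piEquivPiSubtypeProd (fun i => i ∈ Set.range idx) fun _ => κ).trans
      (Equiv.prodCongr (Equiv.arrowCongr (Equiv.ofInjective idx hidx).symm (Equiv.refl κ))
        (Equiv.refl _))
  have he : ∀ ω, (e ω).1 = ω ∘ idx := fun ω => rfl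
  have h1 : (univ.filter fun ω : ι → κ => E (ω ∘ idx)).card =
      ((univ.filter E) ×ˢ (univ : Finset ({i // i ∉ Set.range idx} → κ))).card := by
    refine card_equiv e fun ω => ?_
    simp [he]
  rw [h1, card_product, card_univ, Fintype.card_congr e, Fintype.card_prod]
  ring

/-- A residue of a uniform number below a multiple of `d` is uniform. -/
lemma sum_range_mul_mod (d q : ℕ) (h : ℕ → ℝ) :
    ∑ k ∈ range (d * q), h (k % d) = q * ∑ k ∈ range d, h k := by
  induction q with
  | zero => simp
  | succ q ih =>
    rw [Nat.mul_succ, sum_range_add, ih]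
    simp only [Nat.mul_add_mod]
    have : ∑ k ∈ range d, h (k % d) = ∑ k ∈ range d, h k :=
      sum_congr rfl fun k hk => by rw [Nat.mod_eq_of_lt (mem_range.1 hk)]
    rw [this]
    push_cast; ring

/-- An element of `s` picked by a number; `v` if there is none. -/
noncomputable def pick {V : Type*} [LinearOrder V] (v : V) (s : Finset V) (k : ℕ) : V :=
  if h : s.Nonempty then s.orderEmbOfFin rfl ⟨k % s.card, Nat.mod_lt _ (card_pos.2 h)⟩ else v

lemma pick_mem {V : Type*} [LinearOrder V] {v : V} {s : Finset V} (h : s.Nonempty) (k : ℕ) :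
    pick v s k ∈ s := by
  rw [pick, dif_pos h]; exact orderEmbOfFin_mem _ _ _

lemma pick_empty {V : Type*} [LinearOrder V] (v : V) (k : ℕ) : pick v ∅ k = v := by
  simp [pick]

/-- The average over a uniform number is the average over the set. -/
lemma card_mul_sum_pick {V : Type*} [LinearOrder V] (v : V) {s : Finset V} (hs : s.Nonempty)
    {Q : ℕ} (hQ : s.card ∣ Q) (g : V → ℝ) :
    s.card * ∑ k : Fin Q, g (pick v s k) = Q * ∑ u ∈ s, g u := by
  obtain ⟨q, rfl⟩ := hQ
  have h1 : ∑ k ∈ range s.card, g (pick v s k) = ∑ u ∈ s, g u := by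
    rw [← Fin.sum_univ_eq_sum_range (fun k => g (pick v s k))]
    conv_rhs => rw [← image_orderEmbOfFin_univ s rfl]
    rw [sum_image (s.orderEmbOfFin rfl).injective.injOn]
    refine sum_congr rfl fun k _ => ?_
    simp [pick, hs, Nat.mod_eq_of_lt k.2]
  have h2 : ∀ k, pick v s k = pick v s (k % s.card) := fun k => by simp [pick]
  rw [Fin.sum_univ_eq_sum_range (fun k => g (pick v s k)),
    sum_congr rfl fun k _ => by rw [h2], sum_range_mul_mod s.card q fun k => g (pick v s k), h1]
  push_cast; ring

end FiniteProb

namespace CorrClust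

open Finset FiniteProb

section Sampling

open Classical

variable {n : ℕ}

/-- The nodes ordered by degree, with ties broken by the identifier. -/
def Prec (d : Fin n → ℕ) (v u : Fin n) : Prop := d v < d u ∨ d v = d u ∧ v < u

/-- The edge `vu`, oriented by `Prec`, leaves or enters `C`. -/
def Crosses (d : Fin n → ℕ) (C : Finset (Fin n)) (v u : Fin n) : Prop :=
  Prec d v u ∧ ¬ (v ∈ C ↔ u ∈ C)

/-- The estimate of the number of edges that leave `C`, from `L` sampled neighbours `σ v j` of each
node `v` of degree `d v`; an edge is counted at its endpoint of smaller degree. -/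
noncomputable def cutEst (L : ℕ) (d : Fin n → ℕ) (σ : Fin n → Fin L → Fin n)
    (C : Finset (Fin n)) : ℝ :=
  ∑ v, ∑ j, if Crosses d C v (σ v j) then (d v : ℝ) / L else 0

/-- The estimate of the number of disagreements at the nodes of the cluster `C`. -/
noncomputable def est (L : ℕ) (d : Fin n → ℕ) (σ : Fin n → Fin L → Fin n)
    (C : Finset (Fin n)) : ℝ :=
  (C.card : ℝ) ^ 2 - ∑ v ∈ C, ((d v : ℝ) + 1) + 2 * cutEst L d σ C

noncomputable def deg (G : SimpleGraph (Fin n)) (v : Fin n) : ℕ := (nbrs G v).card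

/-- The number of edges that leave `C`. -/
noncomputable def cut (G : SimpleGraph (Fin n)) (C : Finset (Fin n)) : ℕ :=
  ∑ v, ((nbrs G v).filter (Crosses (deg G) C v)).card

/-- The part of `cut` at nodes with degree in `[2 ^ i, 2 ^ (i + 1))`. -/
noncomputable def cutClass (G : SimpleGraph (Fin n)) (i : ℕ) (C : Finset (Fin n)) : ℕ :=
  ∑ v with Nat.log 2 (deg G v) = i, ((nbrs G v).filter (Crosses (deg G) C v)).card

lemma prec_trichotomy (d : Fin n → ℕ) {u v : Fin n} (h : u ≠ v) :
    Prec d v u ↔ ¬ Prec d u v := by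
  rw [Ne, Fin.ext_iff] at h
  simp only [Prec, Fin.lt_def]
  omega

lemma cut_eq (G : SimpleGraph (Fin n)) (C : Finset (Fin n)) :
    cut G C = ∑ v ∈ C, (nbrs G v \ C).card := by
  set d := deg G
  set f : Fin n → Fin n → ℕ := fun v u => if (G.Adj v u ∧ Prec d v u) ∧ v ∈ C ∧ u ∉ C then 1 else 0
  set g : Fin n → Fin n → ℕ := fun v u => if (G.Adj v u ∧ Prec d u v) ∧ v ∈ C ∧ u ∉ C then 1 else 0
  have h1 : cut G C = ∑ v, ∑ u, (f v u + g u v) := by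
    refine sum_congr rfl fun v _ => ?_
    rw [card_filter, nbrs, sum_filter]
    refine sum_congr rfl fun u _ => ?_
    simp only [f, g, Crosses, G.adj_comm u v]
    by_cases h1 : v ∈ C <;> by_cases h2 : u ∈ C <;> by_cases h3 : G.Adj v u <;>
      by_cases h4 : Prec d v u <;> simp [h1, h2, h3, h4, d]
  have h2 : ∑ v ∈ C, (nbrs G v \ C).card = ∑ v, ∑ u, (f v u + g v u) := by
    have h : ∀ v, ∑ u, (f v u + g v u) = if v ∈ C then (nbrs G v \ C).card else 0 := by
      intro v
      split_ifs with hv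
      · rw [show nbrs G v \ C = univ.filter fun u => G.Adj v u ∧ u ∉ C by ext; simp, card_filter]
        refine sum_congr rfl fun u _ => ?_
        by_cases h3 : G.Adj v u
        · have := prec_trichotomy d h3.ne'
          by_cases h4 : Prec d v u <;> simp_all [f, g]
        · simp [f, g, h3]
      · simp [f, g, hv]
    rw [sum_congr rfl fun v _ => h v, sum_ite_mem, univ_inter]
  rw [h1, h2]
  simp only [sum_add_distrib]
  rw [sum_comm (f := fun v u => g u v)]

/-- The disagreements of a cluster in terms of its size, its degrees and its cut. -/
lemma contr_eq (G : SimpleGraph (Fin n)) (C : Finset (Fin n)) :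
    (contr G C : ℝ) = (C.card : ℝ) ^ 2 - ∑ v ∈ C, ((deg G v : ℝ) + 1) + 2 * cut G C := by
  have h : ∀ v ∈ C, (dis G v C : ℝ) = C.card - ((deg G v : ℝ) + 1) + 2 * (nbrs G v \ C).card := by
    intro v hv
    have h1 : nbhd G v \ C = nbrs G v \ C := by
      ext u
      simp only [mem_sdiff, mem_nbhd, mem_nbrs]
      constructor
      · rintro ⟨rfl | h, h'⟩
        · exact absurd hv h'
        · exact ⟨h, h'⟩
      · rintro ⟨h, h'⟩; exact ⟨Or.inr h, h'⟩
    have h2 : dis G v C = (nbhd G v \ C).card + (C \ nbhd G v).card := by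
      rw [dis, symmDiff_def, sup_eq_union, card_union_of_disjoint disjoint_sdiff_sdiff]
    have h3 := card_sdiff_add_card (nbhd G v) C
    have h4 := card_sdiff_add_card C (nbhd G v)
    rw [union_comm] at h4
    have h5 := card_nbhd G v
    have h6 : dis G v C + (deg G v + 1) = C.card + 2 * (nbrs G v \ C).card := by
      rw [deg, ← h5, h2, ← h1]; omega
    have h7 : (dis G v C : ℝ) + (deg G v + 1) = C.card + 2 * (nbrs G v \ C).card := by
      exact_mod_cast h6
    linarith
  rw [contr, cut_eq]
  push_cast
  rw [sum_congr rfl h, sum_add_distrib, sum_sub_distrib, ← mul_sum]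
  simp [sq]

lemma cut_le_contr (G : SimpleGraph (Fin n)) (C : Finset (Fin n)) : cut G C ≤ contr G C := by
  rw [cut_eq, contr]
  refine sum_le_sum fun v _ => card_le_card fun u hu => ?_
  rw [mem_sdiff, mem_nbrs] at hu
  simp [mem_symmDiff, hu.1, hu.2]

lemma cutClass_le (G : SimpleGraph (Fin n)) (i : ℕ) (C : Finset (Fin n)) :
    cutClass G i C ≤ cut G C :=
  sum_le_sum_of_subset (filter_subset _ _)

lemma est_sub_contr (G : SimpleGraph (Fin n)) {L : ℕ} (σ : Fin n → Fin L → Fin n)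
    (C : Finset (Fin n)) :
    est L (deg G) σ C - contr G C = 2 * (cutEst L (deg G) σ C - cut G C) := by
  rw [contr_eq, est]; ring

/-- A perfect clustering looks perfect, whatever neighbours are sampled. -/
lemma est_nonpos_of_cost_eq_zero {G : SimpleGraph (Fin n)} {L : ℕ} {σ : Fin n → Fin L → Fin n}
    (hσ : ∀ v j, σ v j ∈ nbhd G v) {P : Setoid (Fin n)} (hP : cost G P = 0) (v : Fin n) :
    est L (deg G) σ (cl P v) ≤ 0 := by
  have hcl := cl_eq_nbhd_of_cost_eq_zero hP
  have h0 : contr G (cl P v) = 0 := by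
    refine sum_eq_zero fun u hu => ?_
    rw [← cl_eq_of_mem hu, dis, hcl, symmDiff_self]
    rfl
  have h1 : cutEst L (deg G) σ (cl P v) = 0 := by
    refine sum_eq_zero fun u _ => sum_eq_zero fun j _ => if_neg fun h => h.2 ?_
    have h2 := hσ u j
    rw [← hcl] at h2
    simp only [mem_cl] at h2 ⊢
    exact ⟨fun h => P.trans h h2, fun h => P.trans h (P.symm h2)⟩
  have h2 := est_sub_contr G σ (cl P v)
  have h3 : (0 : ℝ) ≤ cut G (cl P v) := Nat.cast_nonneg _
  rw [h0, h1] at h2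
  push_cast at h2
  linarith

/-- The sampled neighbours. -/
noncomputable def sample (G : SimpleGraph (Fin n)) {L Q : ℕ} (ω : Fin n × Fin L → Fin Q)
    (v : Fin n) (j : Fin L) : Fin n := pick v (nbrs G v) (ω (v, j))

lemma sample_mem (G : SimpleGraph (Fin n)) {L Q : ℕ} (ω : Fin n × Fin L → Fin Q)
    (v : Fin n) (j : Fin L) : sample G ω v j ∈ nbhd G v := by
  rw [sample]
  rcases (nbrs G v).eq_empty_or_nonempty with h | h
  · rw [h, pick_empty]; simp
  · have := pick_mem (v := v) h (ω (v, j))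
    rw [mem_nbrs] at this
    simp [this]

/-- The contribution of one sample to the estimate of `cutClass G i C`. -/
noncomputable def sampleTerm (G : SimpleGraph (Fin n)) (L Q i : ℕ) (C : Finset (Fin n))
    (a : Fin n × Fin L) (k : Fin Q) : ℝ :=
  if Nat.log 2 (deg G a.1) = i ∧ Crosses (deg G) C a.1 (pick a.1 (nbrs G a.1) k) then
    (deg G a.1 : ℝ) / L else 0

lemma sampleTerm_nonneg (G : SimpleGraph (Fin n)) (L Q i : ℕ) (C : Finset (Fin n))
    (a : Fin n × Fin L) (k : Fin Q) : 0 ≤ sampleTerm G L Q i C a k := by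
  rw [sampleTerm]; split_ifs <;> positivity

lemma sampleTerm_le (G : SimpleGraph (Fin n)) (L Q i : ℕ) (C : Finset (Fin n))
    (a : Fin n × Fin L) (k : Fin Q) : sampleTerm G L Q i C a k ≤ 2 * 2 ^ i / L := by
  rw [sampleTerm]
  split_ifs with h
  · have := Nat.lt_pow_succ_log_self (b := 2) (by norm_num) (deg G a.1)
    rw [h.1, pow_succ] at this
    have : (deg G a.1 : ℝ) ≤ 2 * 2 ^ i := by
      rw [mul_comm]; exact_mod_cast this.le
    gcongr
  · positivity

lemma not_prec_self (d : Fin n → ℕ) (v : Fin n) : ¬ Prec d v v := by simp [Prec]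

lemma mean_sampleTerm (G : SimpleGraph (Fin n)) {L : ℕ} (hL : 0 < L) (i : ℕ)
    (C : Finset (Fin n)) :
    ∑ a, (∑ k, sampleTerm G L n.factorial i C a k) / Fintype.card (Fin n.factorial) =
      cutClass G i C := by
  have hL' : (L : ℝ) ≠ 0 := by exact_mod_cast hL.ne'
  have hQ' : (n.factorial : ℝ) ≠ 0 := by exact_mod_cast n.factorial_ne_zero
  have key : ∀ v (j : Fin L), (∑ k, sampleTerm G L n.factorial i C (v, j) k) / n.factorial =
      (if Nat.log 2 (deg G v) = i then (((nbrs G v).filter (Crosses (deg G) C v)).card : ℝ)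
        else 0) / L := by
    intro v j
    simp only [sampleTerm]
    by_cases hi : Nat.log 2 (deg G v) = i
    swap
    · simp [hi]
    simp only [hi, true_and, if_true]
    rcases (nbrs G v).eq_empty_or_nonempty with h | h
    · simp [h, pick_empty, Crosses, not_prec_self]
    · have h1 := card_mul_sum_pick v h (Nat.dvd_factorial (card_pos.2 h) (card_nbrs_lt G v).le)
        fun u => if Crosses (deg G) C v u then (1 : ℝ) else 0
      have h2 : ∀ k : Fin n.factorial, (if Crosses (deg G) C v (pick v (nbrs G v) k) then
          (deg G v : ℝ) / L else 0) = (deg G v : ℝ) / L *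
            if Crosses (deg G) C v (pick v (nbrs G v) k) then (1 : ℝ) else 0 := by
        intro k; split_ifs <;> simp
      rw [sum_congr rfl fun k _ => h2 k, ← mul_sum, card_filter]
      push_cast
      rw [deg]
      field_simp
      linarith
  rw [Fintype.card_fin, Fintype.sum_prod_type]
  simp only [key]
  rw [cutClass, sum_filter]
  push_cast
  refine sum_congr rfl fun v _ => ?_
  rw [sum_const, card_univ, Fintype.card_fin, nsmul_eq_mul]
  field_simp

end Sampling
end CorrClust

namespace CorrClust

open Finset FiniteProb

section UnionBound

open Classical

variable {n : ℕ}

/-- The number of degree classes. -/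
def numClasses (n : ℕ) : ℕ := Nat.log 2 n + 1

lemma log_deg_lt (G : SimpleGraph (Fin n)) (v : Fin n) : Nat.log 2 (deg G v) < numClasses n :=
  Nat.lt_succ_of_le (Nat.log_mono_right (card_nbrs_lt G v).le)

lemma cut_eq_sum_cutClass (G : SimpleGraph (Fin n)) (C : Finset (Fin n)) :
    cut G C = ∑ i ∈ range (numClasses n), cutClass G i C :=
  (sum_fiberwise_of_maps_to (fun v _ => mem_range.2 (log_deg_lt G v)) _).symm

lemma cutEst_eq_sum (G : SimpleGraph (Fin n)) {L Q : ℕ} (ω : Fin n × Fin L → Fin Q)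
    (C : Finset (Fin n)) :
    cutEst L (deg G) (sample G ω) C =
      ∑ i ∈ range (numClasses n), ∑ a, sampleTerm G L Q i C a (ω a) := by
  rw [sum_comm, cutEst, Fintype.sum_prod_type]
  refine sum_congr rfl fun v _ => sum_congr rfl fun j _ => ?_
  simp only [sampleTerm, sample, ite_and]
  rw [sum_ite_eq, if_pos (mem_range.2 (log_deg_lt G v))]
  congr

/-- The sets `R` and `nbhd G v ∆ R`. -/
noncomputable def variation (G : SimpleGraph (Fin n)) (K : Option (Fin n)) (R : Finset (Fin n)) :
    Finset (Fin n) := symmDiff (K.elim ∅ (nbhd G)) R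

/-- On the nodes of degree at least `D`, each set is a variation of the empty set or of a closed
neighbourhood by few nodes, compared with its disagreements. -/
lemma exists_variation (G : SimpleGraph (Fin n)) {C : Finset (Fin n)} (hC : C.Nonempty) {D : ℕ}
    (hD : 0 < D) :
    (∀ v, D ≤ deg G v → v ∉ C) ∨ ∃ K R, (∀ v, D ≤ deg G v → (v ∈ variation G K R ↔ v ∈ C)) ∧
      (R.card + 1) * D ≤ 4 * (contr G C + C.card) := by
  have hF : contr G C + C.card = ∑ v ∈ C, (dis G v C + 1) := by
    rw [sum_add_distrib, contr, card_eq_sum_ones]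
  by_cases hlarge : D ≤ 2 * C.card
  · right
    obtain ⟨v, hv, hmin⟩ := exists_min_image C (fun v => dis G v C) hC
    refine ⟨some v, symmDiff (nbhd G v) C, fun u _ => ?_, ?_⟩
    · simp [variation]
    · change (dis G v C + 1) * D ≤ _
      have : C.card * (dis G v C + 1) ≤ contr G C + C.card := by
        rw [hF, ← smul_eq_mul]
        exact card_nsmul_le_sum _ _ _ fun u hu => Nat.add_le_add_right (hmin u hu) 1
      calc (dis G v C + 1) * D ≤ (dis G v C + 1) * (2 * C.card) := by gcongr
        _ = 2 * (C.card * (dis G v C + 1)) := by ring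
        _ ≤ _ := by omega
  · push Not at hlarge
    set B := C.filter fun v => D ≤ deg G v with hB
    rcases B.eq_empty_or_nonempty with h | h
    · left
      intro v hv hvC
      exact notMem_empty v (h ▸ mem_filter.2 ⟨hvC, hv⟩)
    · right
      refine ⟨none, B, fun v hv => ?_, ?_⟩
      · simp [variation, hB, mem_symmDiff, hv]
      · have h1 : B.card * D ≤ 2 * (contr G C + C.card) := by
          rw [hF, mul_sum]
          refine le_trans ?_ (sum_le_sum_of_subset (filter_subset (fun v => D ≤ deg G v) C))
          rw [← smul_eq_mul]
          refine card_nsmul_le_sum _ _ _ fun v hv => ?_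
          have h2 : (nbhd G v).card - C.card ≤ dis G v C :=
            (le_card_sdiff _ _).trans (card_le_card le_sup_left)
          have h3 := (mem_filter.1 hv).2
          rw [card_nbhd] at h2
          rw [deg] at h3
          omega
        have h2 : 1 ≤ B.card := card_pos.2 h
        nlinarith

/-- The estimate of `cutClass G i C` is off by more than `τ * (cutClass G i C + y)`. -/
def Deviates (G : SimpleGraph (Fin n)) {L Q : ℕ} (τ : ℝ) (i : ℕ) (C : Finset (Fin n)) (y : ℝ)
    (ω : Fin n × Fin L → Fin Q) : Prop :=
  τ * (cutClass G i C + y) < |∑ a, sampleTerm G L Q i C a (ω a) - cutClass G i C|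

lemma card_deviates_le (G : SimpleGraph (Fin n)) {L : ℕ} (hL : 0 < L) {τ : ℝ} (hτ0 : 0 < τ)
    (hτ1 : τ ≤ 1) (i : ℕ) (C : Finset (Fin n)) (r : ℕ) :
    ((univ.filter fun ω : Fin n × Fin L → Fin n.factorial =>
        Deviates G τ i C (r * 2 ^ i / 4) ω).card : ℝ) ≤
      2 * Real.exp (-(τ ^ 2 * L / 32)) ^ r *
        Fintype.card (Fin n × Fin L → Fin n.factorial) := by
  have hL' : (0 : ℝ) < L := by exact_mod_cast hL
  have : Nonempty (Fin n.factorial) := ⟨⟨0, n.factorial_pos⟩⟩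
  have h := card_deviation_le (w := 2 * 2 ^ i / L) (τ := τ) (by positivity)
    (fun a k => sampleTerm_nonneg G L n.factorial i C a k)
    (fun a k => sampleTerm_le G L n.factorial i C a k) hτ0 hτ1
    (F := cutClass G i C + r * 2 ^ i / 4)
    (by rw [mean_sampleTerm G hL]; have : (0 : ℝ) ≤ r * 2 ^ i / 4 := by positivity
        linarith)
  rw [mean_sampleTerm G hL] at h
  refine h.trans ?_
  rw [← Real.exp_nat_mul]
  gcongr
  have h0 : (0 : ℝ) ≤ cutClass G i C := Nat.cast_nonneg _
  have h1 : (r : ℝ) * (τ ^ 2 * L / 32) = τ ^ 2 * (r * 2 ^ i / 4) / (4 * (2 * 2 ^ i / L)) := by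
    field_simp; ring
  rw [mul_neg, h1]
  refine neg_le_neg ?_
  gcongr
  linarith

/-- No class of edges deviates on any variation. -/
def NoDeviation (G : SimpleGraph (Fin n)) {L Q : ℕ} (τ : ℝ) (ω : Fin n × Fin L → Fin Q) : Prop :=
  ∀ i < numClasses n, ∀ K R,
    ¬ Deviates G τ i (variation G K R) (((R.card + 1 : ℕ) : ℝ) * 2 ^ i / 4) ω

lemma card_not_noDeviation_le (G : SimpleGraph (Fin n)) {L : ℕ} (hL : 0 < L) {τ : ℝ}
    (hτ0 : 0 < τ) (hτ1 : τ ≤ 1) {z : ℝ} (hz : Real.exp (-(τ ^ 2 * L / 32)) ≤ z)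
    (hnz : n * z ≤ 1) :
    ((univ.filter fun ω : Fin n × Fin L → Fin n.factorial => ¬ NoDeviation G τ ω).card : ℝ) ≤
      6 * numClasses n * (n + 1) * z * Fintype.card (Fin n × Fin L → Fin n.factorial) := by
  set N : ℝ := (Fintype.card (Fin n × Fin L → Fin n.factorial) : ℝ)
  have hz0 : 0 ≤ z := (Real.exp_pos _).le.trans hz
  set Bad : ℕ → Option (Fin n) → Finset (Fin n) → Finset (Fin n × Fin L → Fin n.factorial) :=
    fun i K R => univ.filter fun ω =>
      Deviates G τ i (variation G K R) (((R.card + 1 : ℕ) : ℝ) * 2 ^ i / 4) ω with hBad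
  have hsub : (univ.filter fun ω : Fin n × Fin L → Fin n.factorial => ¬ NoDeviation G τ ω) ⊆
      (range (numClasses n) ×ˢ (univ : Finset (Option (Fin n) × Finset (Fin n)))).biUnion
        fun x => Bad x.1 x.2.1 x.2.2 := by
    intro ω hω
    have hω := (mem_filter.1 hω).2
    simp only [NoDeviation, not_forall, not_not] at hω
    obtain ⟨i, hi, K, R, h⟩ := hω
    refine mem_biUnion.2 ⟨(i, K, R), by simp [hi], ?_⟩
    simp only [hBad, mem_filter, mem_univ, true_and]
    exact h
  have hpow : ∑ R : Finset (Fin n), z ^ (R.card + 1) ≤ 3 * z := by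
    have h1 : ∑ R : Finset (Fin n), z ^ R.card = (z + 1) ^ n := by
      have := sum_pow_mul_eq_add_pow z 1 (univ : Finset (Fin n))
      simpa using this
    have h2 : (z + 1) ^ n ≤ 3 := by
      calc (z + 1) ^ n ≤ Real.exp z ^ n := by
            gcongr; exact Real.add_one_le_exp z
        _ = Real.exp (n * z) := (Real.exp_nat_mul _ _).symm
        _ ≤ Real.exp 1 := Real.exp_le_exp.2 hnz
        _ ≤ 3 := Real.exp_one_lt_three.le
    simp only [pow_succ, ← sum_mul, h1]
    gcongr
  calc ((univ.filter fun ω : Fin n × Fin L → Fin n.factorial => ¬ NoDeviation G τ ω).card : ℝ)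
      ≤ ∑ x ∈ range (numClasses n) ×ˢ (univ : Finset (Option (Fin n) × Finset (Fin n))),
          ((Bad x.1 x.2.1 x.2.2).card : ℝ) := by
        exact_mod_cast (card_le_card hsub).trans card_biUnion_le
    _ ≤ ∑ x ∈ range (numClasses n) ×ˢ (univ : Finset (Option (Fin n) × Finset (Fin n))),
          2 * z ^ (x.2.2.card + 1) * N := by
        refine sum_le_sum fun x _ => ?_
        refine (card_deviates_le G hL hτ0 hτ1 x.1 _ (x.2.2.card + 1)).trans ?_
        gcongr
    _ = numClasses n * ((n + 1) * (2 * (∑ R : Finset (Fin n), z ^ (R.card + 1)) * N)) := by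
        rw [sum_product]
        dsimp only
        rw [sum_const, card_range, nsmul_eq_mul, Fintype.sum_prod_type]
        dsimp only
        rw [sum_const, card_univ, Fintype.card_option, Fintype.card_fin, nsmul_eq_mul, ← sum_mul, ← mul_sum]
        push_cast; ring
    _ ≤ numClasses n * ((n + 1) * (2 * (3 * z) * N)) := by gcongr
    _ = _ := by ring

lemma crosses_congr {G : SimpleGraph (Fin n)} {A C : Finset (Fin n)} {D : ℕ}
    (h : ∀ v, D ≤ deg G v → (v ∈ A ↔ v ∈ C)) {v u : Fin n} (hv : D ≤ deg G v) :
    Crosses (deg G) A v u ↔ Crosses (deg G) C v u := by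
  refine and_congr_right fun hp => ?_
  have hu : D ≤ deg G u := by
    rcases hp with h | h <;> omega
  rw [h v hv, h u hu]

lemma cutClass_congr {G : SimpleGraph (Fin n)} {A C : Finset (Fin n)} {i : ℕ}
    (h : ∀ v, 2 ^ i ≤ deg G v → (v ∈ A ↔ v ∈ C)) : cutClass G i A = cutClass G i C := by
  refine sum_congr rfl fun v hv => ?_
  have hv := (mem_filter.1 hv).2
  rcases Nat.eq_zero_or_pos (deg G v) with h0 | h0
  · rw [card_eq_zero.1 h0]; simp
  · have := Nat.pow_log_le_self 2 h0.ne'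
    rw [hv] at this
    simp only [crosses_congr h this]

lemma sampleTerm_congr {G : SimpleGraph (Fin n)} {A C : Finset (Fin n)} {i L Q : ℕ}
    (h : ∀ v, 2 ^ i ≤ deg G v → (v ∈ A ↔ v ∈ C)) (a : Fin n × Fin L) (k : Fin Q) :
    sampleTerm G L Q i A a k = sampleTerm G L Q i C a k := by
  simp only [sampleTerm]
  rcases Nat.eq_zero_or_pos (deg G a.1) with h0 | h0
  · simp [h0]
  · refine if_congr (and_congr_right fun hv => ?_) rfl rfl
    have := Nat.pow_log_le_self 2 h0.ne'
    rw [hv] at this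
    exact crosses_congr h this

lemma NoDeviation.goodEstimate {G : SimpleGraph (Fin n)} {L Q : ℕ}
    {ω : Fin n × Fin L → Fin Q} (h : NoDeviation G (1 / (36 * numClasses n)) ω) :
    GoodEstimate G (est L (deg G) (sample G ω)) := by
  intro C hC
  set Λ : ℝ := (numClasses n : ℝ) with hΛ
  have hΛ0 : 0 < Λ := by rw [hΛ]; exact_mod_cast Nat.succ_pos _
  set F : ℝ := contr G C + C.card with hF
  have hF0 : 0 ≤ F := by positivity
  have key : ∀ i ∈ range (numClasses n),
      |∑ a, sampleTerm G L Q i C a (ω a) - cutClass G i C| ≤ 1 / (36 * Λ) * (2 * F) := by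
    intro i hi
    rcases exists_variation G hC (D := 2 ^ i) (by positivity) with hempty | ⟨K, R, hKR, hcard⟩
    · have h0 : ∀ v, 2 ^ i ≤ deg G v → (v ∈ (∅ : Finset (Fin n)) ↔ v ∈ C) := fun v hv => by
        simp [hempty v hv]
      rw [← cutClass_congr h0]
      simp only [← sampleTerm_congr h0]
      have h1 : ∀ a k, sampleTerm G L Q i ∅ a k = 0 := by simp [sampleTerm, Crosses]
      have h2 : cutClass G i ∅ = 0 := by simp [cutClass, Crosses]
      simp only [h1, h2, sum_const_zero, Nat.cast_zero, sub_zero, abs_zero]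
      positivity
    · have h1 := not_lt.1 (h i (mem_range.1 hi) K R)
      rw [cutClass_congr hKR] at h1
      simp only [sampleTerm_congr hKR] at h1
      refine h1.trans ?_
      gcongr
      have h2 : (cutClass G i C : ℝ) ≤ contr G C := by
        exact_mod_cast (cutClass_le G i C).trans (cut_le_contr G C)
      have h3 : ((R.card + 1 : ℕ) : ℝ) * 2 ^ i ≤ 4 * F := by
        rw [hF]; exact_mod_cast hcard
      have h4 : (0 : ℝ) ≤ C.card := Nat.cast_nonneg _
      linarith
  rw [est_sub_contr, cutEst_eq_sum, cut_eq_sum_cutClass, abs_mul, abs_two]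
  push_cast
  rw [← sum_sub_distrib]
  have h1 := (abs_sum_le_sum_abs _ _).trans (sum_le_sum key)
  rw [sum_const, card_range, nsmul_eq_mul, ← hΛ] at h1
  have h2 : Λ * (1 / (36 * Λ) * (2 * F)) = F / 18 := by field_simp; ring
  rw [h2] at h1
  linarith

/-- The number of samples per node that makes the estimate good with probability
`1 - 1 / n ^ (c + 2)`. -/
def numSamples (c n : ℕ) : ℕ := 41472 * (c + 8) * numClasses n ^ 3

lemma card_not_goodEstimate_le (c : ℕ) (hn : 2 ≤ n) (G : SimpleGraph (Fin n)) :
    ((univ.filter fun ω : Fin n × Fin (numSamples c n) → Fin n.factorial =>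
      ¬ GoodEstimate G (est (numSamples c n) (deg G) (sample G ω))).card : ℝ) ≤
      1 / (n : ℝ) ^ (c + 2) * Fintype.card (Fin n × Fin (numSamples c n) → Fin n.factorial) := by
  set L := numSamples c n with hLdef
  have hΛ : 0 < numClasses n := Nat.succ_pos _
  have hΛ' : (1 : ℝ) ≤ numClasses n := by exact_mod_cast hΛ
  have hL : 0 < L := by rw [hLdef, numSamples]; positivity
  have hn0 : (0 : ℝ) < n := by exact_mod_cast (by omega : 0 < n)
  have hn2 : (2 : ℝ) ≤ n := by exact_mod_cast hn
  have hexp : Real.exp (-((1 / (36 * numClasses n : ℝ)) ^ 2 * L / 32)) ≤ 1 / (n : ℝ) ^ (c + 8) := by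
    have h1 : (1 / (36 * numClasses n : ℝ)) ^ 2 * L / 32 = ((c + 8 : ℕ) : ℝ) * numClasses n := by
      rw [hLdef, numSamples]
      push_cast
      field_simp
      norm_num
    rw [h1, Real.exp_neg, one_div, Real.exp_nat_mul]
    gcongr
    calc (n : ℝ) ≤ 2 ^ numClasses n := by
          exact_mod_cast (Nat.lt_pow_succ_log_self (by norm_num) n).le
      _ ≤ Real.exp 1 ^ numClasses n := by
          gcongr
          linarith [Real.add_one_le_exp (1 : ℝ)]
      _ = Real.exp (numClasses n) := by rw [← Real.exp_nat_mul, mul_one]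
  have hsub := card_le_card (monotone_filter_right univ fun (ω : Fin n × Fin L → Fin n.factorial) _
    (h : ¬ GoodEstimate G (est L (deg G) (sample G ω))) =>
      mt (NoDeviation.goodEstimate (G := G) (ω := ω)) h)
  have h1 := card_not_noDeviation_le G hL (τ := 1 / (36 * numClasses n : ℝ)) (by positivity)
    (by rw [div_le_one (by positivity)]; linarith) hexp
    (by rw [mul_one_div, div_le_one (by positivity)]; exact le_self_pow₀ (by linarith) (by omega))
  refine (Nat.cast_le.2 hsub).trans (h1.trans ?_)
  gcongr
  have h2 : (numClasses n : ℝ) ≤ n := by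
    exact_mod_cast Nat.succ_le_of_lt (Nat.log_lt_self 2 (by omega))
  have h3 : (n : ℝ) + 1 ≤ 2 * n := by linarith
  have h4 : (12 : ℝ) ≤ n ^ 4 := by
    calc (12 : ℝ) ≤ 2 ^ 4 := by norm_num
      _ ≤ n ^ 4 := by gcongr
  rw [mul_one_div, div_le_div_iff₀ (by positivity) (by positivity), one_mul]
  calc 6 * (numClasses n : ℝ) * (n + 1) * n ^ (c + 2) ≤ 6 * n * (2 * n) * n ^ (c + 2) := by gcongr
    _ = 12 * n ^ (c + 4) := by ring
    _ ≤ n ^ 4 * n ^ (c + 4) := by gcongr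
    _ = n ^ (c + 8) := by ring

end UnionBound

end CorrClust

namespace MPC

open Finset CorrClust

section Gather

open Classical

variable {n M L : ℕ}

/-! ### Lists of words indexed by nodes or machines -/

lemma flatMap_ite_eq {α β : Type*} [DecidableEq α] (l : List α) (hl : l.Nodup) {a : α} (ha : a ∈ l)
    (f : α → List β) : (l.flatMap fun b => if b = a then f b else []) = f a := by
  induction l with
  | nil => simp at ha
  | cons b l ih =>
    rw [List.flatMap_cons]
    rw [List.nodup_cons] at hl
    by_cases hb : b = a
    · subst hb
      have : (l.flatMap fun c => if c = b then f c else []) = [] := by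
        rw [List.flatMap_eq_nil_iff]
        intro c hc
        rw [if_neg]
        rintro rfl
        exact hl.1 hc
      simp [this]
    · rw [if_neg hb, List.nil_append]
      exact ih hl.2 ((List.mem_cons.1 ha).resolve_left (Ne.symm hb))

lemma filter_flatMap_finRange {b : Fin n → List (Word n)}
    (hb : ∀ u, ∀ w ∈ b u, w.1 = u.castSucc) (v : Fin n) :
    ((List.finRange n).flatMap b).filter (fun w => w.1 = v.castSucc) = b v := by
  rw [List.filter_flatMap, ← flatMap_ite_eq (List.finRange n) (List.nodup_finRange n)
    (List.mem_finRange v) b]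
  congr 1
  funext u
  split_ifs with h
  · subst h
    exact List.filter_eq_self.2 fun w hw => by simpa using hb u w hw
  · refine List.filter_eq_nil_iff.2 fun w hw => ?_
    have := hb u w hw
    simp only [this, decide_eq_true_eq]
    exact fun h' => h (Fin.castSucc_injective n h')

lemma length_flatMap_finRange (b : Fin n → List (Word n)) :
    ((List.finRange n).flatMap b).length = ∑ v, (b v).length := by
  rw [List.length_flatMap, Fin.sum_univ_def]

lemma sum_length_flatMap (place : Fin n → Fin M) (b : Fin M → Fin n → List (Word n)) :
    ∑ j, ((List.finRange n).flatMap fun v => if place v = j then b j v else []).length =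
      ∑ v, (b (place v) v).length := by
  simp only [length_flatMap_finRange]
  rw [sum_comm]
  refine sum_congr rfl fun v _ => ?_
  rw [sum_eq_single (place v)]
  · simp
  · intro j _ hj; simp [hj.symm]
  · simp

/-! ### The input -/

lemma mem_inputWords {G : SimpleGraph (Fin n)} {place : Fin n → Fin M} {i : Fin M}
    {v u : Fin n} : (v.castSucc, u.castSucc) ∈ inputWords G place i ↔
      place v = i ∧ (u = v ∨ G.Adj v u) := by
  simp only [inputWords, List.mem_flatMap, List.mem_finRange, true_and]
  constructor
  · rintro ⟨x, hx⟩
    split_ifs at hx with h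
    · simp only [nodeRecord, List.mem_cons, Prod.mk.injEq, Fin.castSucc_inj, List.mem_map,
        List.mem_filter, List.mem_finRange, true_and, decide_eq_true_eq] at hx
      rcases hx with ⟨rfl, rfl⟩ | ⟨y, hy, rfl, rfl⟩
      · exact ⟨h, Or.inl rfl⟩
      · exact ⟨h, Or.inr hy⟩
    · simp at hx
  · rintro ⟨h, hu⟩
    refine ⟨v, ?_⟩
    rw [if_pos h]
    simp only [nodeRecord, List.mem_cons, Prod.mk.injEq, Fin.castSucc_inj, List.mem_map,
        List.mem_filter, List.mem_finRange, true_and, decide_eq_true_eq]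
    rcases hu with rfl | hu
    · exact Or.inl rfl
    · exact Or.inr ⟨u, hu, rfl⟩

lemma length_nodeRecord (G : SimpleGraph (Fin n)) (v : Fin n) :
    (nodeRecord G v).length = deg G v + 1 := by
  rw [nodeRecord, List.length_cons, List.length_map, deg, nbrs, Fin.univ_def]
  rfl

lemma length_inputWords (G : SimpleGraph (Fin n)) (place : Fin n → Fin M) (i : Fin M) :
    (inputWords G place i).length = ∑ v with place v = i, (deg G v + 1) := by
  rw [inputWords, length_flatMap_finRange, sum_filter]
  refine sum_congr rfl fun v _ => ?_
  split_ifs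
  · exact length_nodeRecord G v
  · rfl

lemma sum_deg_add_one (G : SimpleGraph (Fin n)) :
    ∑ v, (deg G v + 1) = 2 * G.edgeSet.ncard + n := by
  have h1 := G.sum_degrees_eq_twice_card_edges
  have h2 : ∀ v, G.degree v = deg G v := fun v => by
    rw [deg, ← SimpleGraph.card_neighborFinset_eq_degree]
    congr 1
    ext u
    simp
  have h3 : G.edgeSet.ncard = G.edgeFinset.card := Set.ncard_eq_toFinset_card' _
  rw [sum_add_distrib, h3, ← h1]
  simp [h2]

/-- Machines with room for twice the largest record can be filled greedily. -/
lemma exists_admissible (G : SimpleGraph (Fin n)) {B : ℕ} (hB : n ≤ B) (hB0 : 0 < B) :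
    ∃ place : Fin n → Fin ((n + 2 * G.edgeSet.ncard) / B + 1), Admissible (4 * B) G place := by
  set pre : Fin n → ℕ := fun v => ∑ u with u < v, (deg G u + 1) with hpre
  have hle : ∀ v, pre v ≤ n + 2 * G.edgeSet.ncard := fun v => by
    rw [add_comm, ← sum_deg_add_one]
    exact sum_le_sum_of_subset (filter_subset _ _)
  refine ⟨fun v => ⟨pre v / B, Nat.lt_succ_of_le (Nat.div_le_div_right (hle v))⟩, fun i => ?_⟩
  rw [length_inputWords]
  set W : Finset (Fin n) := univ.filter fun v =>
    (⟨pre v / B, Nat.lt_succ_of_le (Nat.div_le_div_right (hle v))⟩ :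
      Fin ((n + 2 * G.edgeSet.ncard) / B + 1)) = i with hW
  have hmem : ∀ v ∈ W, i * B ≤ pre v ∧ pre v < (i + 1) * B := by
    intro v hv
    have h := congrArg Fin.val (mem_filter.1 hv).2
    simp only at h
    rw [← h]
    exact ⟨Nat.div_mul_le_self _ _, Nat.lt_mul_of_div_lt (Nat.lt_succ_self _) hB0⟩
  rcases W.eq_empty_or_nonempty with h | h
  · simp [h]
  · set z := W.max' h
    set y := W.min' h
    have hz := hmem z (max'_mem W h)
    have hy := hmem y (min'_mem W h)
    have h1 : ∑ u ∈ W.erase z, (deg G u + 1) + pre y ≤ pre z := by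
      rw [hpre, ← sum_union]
      · refine sum_le_sum_of_subset fun u hu => ?_
        rw [mem_filter]
        refine ⟨mem_univ u, ?_⟩
        rcases mem_union.1 hu with hu | hu
        · exact lt_of_le_of_ne (le_max' W u (mem_of_mem_erase hu)) (ne_of_mem_erase hu)
        · exact (mem_filter.1 hu).2.trans_le (min'_le W z (max'_mem W h))
      · rw [disjoint_left]
        intro u hu hu'
        exact absurd (mem_filter.1 hu').2 (min'_le W u (mem_of_mem_erase hu)).not_gt
    have h2 : deg G z + 1 + ∑ u ∈ W.erase z, (deg G u + 1) = ∑ u ∈ W, (deg G u + 1) :=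
      add_sum_erase W (fun u => deg G u + 1) (max'_mem W h)
    have h3 : deg G z < n := card_nbrs_lt G z
    have h4 : ((i : ℕ) + 1) * B = i * B + B := by ring
    omega

/-! ### The algorithm -/

/-- The graph of the edges listed in a memory. -/
def localGraph (l : List (Word n)) : SimpleGraph (Fin n) where
  Adj v u := v ≠ u ∧ ((v.castSucc, u.castSucc) ∈ l ∨ (u.castSucc, v.castSucc) ∈ l)
  symm := ⟨fun _ _ h => ⟨h.1.symm, h.2.symm⟩⟩
  loopless := ⟨fun _ h => h.1 rfl⟩

lemma localGraph_adj {G : SimpleGraph (Fin n)} {place : Fin n → Fin M} {v : Fin n} (u : Fin n) :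
    (localGraph (inputWords G place (place v))).Adj v u ↔ G.Adj v u := by
  simp only [localGraph, mem_inputWords, true_and]
  constructor
  · rintro ⟨h, (rfl | h') | ⟨-, rfl | h'⟩⟩
    · exact absurd rfl h
    · exact h'
    · exact absurd rfl h
    · exact h'.symm
  · exact fun h => ⟨h.ne, Or.inl (Or.inr h)⟩

/-- The report on a node: its degree, its smallest closed neighbour and its sampled neighbours. -/
noncomputable def report (G : SimpleGraph (Fin n)) {Q : ℕ} (ω : Fin n × Fin L → Fin Q)
    (v : Fin n) : List (Word n) :=
  (v.castSucc, ⟨deg G v, (card_nbrs_lt G v).trans (Nat.lt_succ_self n)⟩) ::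
    (v.castSucc, (minNbr G v).castSucc) ::
      List.ofFn fun j => (v.castSucc, (sample G ω v j).castSucc)

lemma fst_of_mem_report {G : SimpleGraph (Fin n)} {Q : ℕ} {ω : Fin n × Fin L → Fin Q}
    {v : Fin n} {w : Word n} (hw : w ∈ report G ω v) : w.1 = v.castSucc := by
  simp only [report, List.mem_cons, List.mem_ofFn] at hw
  rcases hw with rfl | rfl | ⟨j, rfl⟩ <;> rfl

lemma length_report (G : SimpleGraph (Fin n)) {Q : ℕ} (ω : Fin n × Fin L → Fin Q) (v : Fin n) :
    (report G ω v).length = L + 2 := by simp [report]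

lemma report_congr {G H : SimpleGraph (Fin n)} {Q : ℕ} {ω ω' : Fin n × Fin L → Fin Q} {v : Fin n}
    (hG : ∀ u, G.Adj v u ↔ H.Adj v u) (hω : ∀ j, ω (v, j) = ω' (v, j)) :
    report G ω v = report H ω' v := by
  have h1 : nbrs G v = nbrs H v := by ext; simp [hG]
  have h2 : nbhd G v = nbhd H v := by ext; simp [hG]
  simp only [report, deg, minNbr, sample, h1, h2, hω]

/-- A word component read as a node. -/
def toNode (v : Fin n) (x : Fin (n + 1)) : Fin n := if h : x.val < n then ⟨x, h⟩ else v

@[simp] lemma toNode_castSucc (v u : Fin n) : toNode v u.castSucc = u := by simp [toNode]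

/-- The second component of the `k`-th word about the node `v`. -/
def entry (l : List (Word n)) (v : Fin n) (k : ℕ) : Fin (n + 1) :=
  ((l.filter fun w => w.1 = v.castSucc).getD k (0, 0)).2

/-- The clustering chosen from the reports. -/
noncomputable def decode (L : ℕ) (l : List (Word n)) : Setoid (Fin n) :=
  choosePartition (est L (fun v => (entry l v 0 : ℕ)) fun v j => toNode v (entry l v (j + 2)))
    fun v => toNode v (entry l v 1)

lemma decode_eq {G : SimpleGraph (Fin n)} {Q : ℕ} {ω : Fin n × Fin L → Fin Q} {l : List (Word n)}
    (hl : ∀ v, (l.filter fun w => w.1 = v.castSucc) = report G ω v) :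
    decode L l = choosePartition (est L (deg G) (sample G ω)) (minNbr G) := by
  have h0 : ∀ v, (entry l v 0 : ℕ) = deg G v := fun v => by simp [entry, hl, report]
  have h1 : ∀ v, toNode v (entry l v 1) = minNbr G v := fun v => by simp [entry, hl, report]
  have h2 : ∀ v (j : Fin L), toNode v (entry l v (j + 2)) = sample G ω v j := fun v j => by
    simp [entry, hl, report, List.getD_eq_getElem?_getD]
  simp only [decode, h0, h1, h2]

/-- A representative of the cluster of `v`. -/
noncomputable def clusterLabel (P : Setoid (Fin n)) (v : Fin n) : Fin n :=
  (Quotient.mk P v).out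

lemma ker_clusterLabel (P : Setoid (Fin n)) : Setoid.ker (clusterLabel P) = P := by
  refine Setoid.ext fun u v => ?_
  rw [Setoid.ker_def, clusterLabel, clusterLabel, Quotient.out_inj]
  exact Quotient.eq

/-- The first round: the reports on all hosted nodes are sent to the machine `0`. -/
noncomputable def reportAction {Q : ℕ} (ω : Fin n × Fin L → Fin Q) (x : Memory n (M + 1)) :
    Action n (M + 1) where
  keep := []
  send j := if j = 0 then (List.finRange n).flatMap fun v =>
    if (v.castSucc, v.castSucc) ∈ x.kept then report (localGraph x.kept) ω v else [] else []

/-- The second round: the machine `0` sends the label of each node to its host. -/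
noncomputable def answerAction (L : ℕ) (i : Fin (M + 1)) (x : Memory n (M + 1)) :
    Action n (M + 1) where
  keep := []
  send j := if i = 0 then (List.finRange n).flatMap fun v =>
    if ∃ w ∈ x.inbox j, w.1 = v.castSucc then
      [(v.castSucc, (clusterLabel (decode L ((List.finRange (M + 1)).flatMap x.inbox)) v).castSucc)]
    else [] else []

/-- The seeds: a number for each node and each of its samples. -/
noncomputable def seedEquiv (n L : ℕ) :
    (Fin n × Fin L → Fin n.factorial) ≃ Fin (Fintype.card (Fin n × Fin L → Fin n.factorial)) :=
  Fintype.equivFin _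

/-- The two-round algorithm with `L` samples per node. -/
noncomputable def sampling (n M L : ℕ) : Algorithm n (M + 1) 2 where
  seeds := Fintype.card (Fin n × Fin L → Fin n.factorial)
  seeds_pos := Fintype.card_pos_iff.2 ⟨fun _ => ⟨0, n.factorial_pos⟩⟩
  step t i s x := if t = 0 then reportAction ((seedEquiv n L).symm s) x else answerAction L i x
  label _ x v := toNode v (entry (x.inbox 0) v 0)

/-- The numbers that determine the samples. -/
noncomputable def seedNumbers (place : Fin n → Fin (M + 1)) (ω : (sampling n M L).Seeds)
    (a : Fin n × Fin L) : Fin n.factorial := (seedEquiv n L).symm (ω 0 (place a.1)) a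

/-- The clustering that the algorithm computes. -/
noncomputable def outcome (G : SimpleGraph (Fin n)) (place : Fin n → Fin (M + 1))
    (ω : (sampling n M L).Seeds) : Setoid (Fin n) :=
  choosePartition (est L (deg G) (sample G (seedNumbers place ω))) (minNbr G)

variable (G : SimpleGraph (Fin n)) (place : Fin n → Fin (M + 1)) (ω : (sampling n M L).Seeds)

lemma action_zero (i : Fin (M + 1)) :
    (sampling n M L).action G place ω 0 i = ⟨[], fun j => if j = 0 then
      (List.finRange n).flatMap fun v => if place v = i then report G (seedNumbers place ω) v else []
      else []⟩ := by
  change reportAction ((seedEquiv n L).symm (ω 0 i)) ⟨inputWords G place i, fun _ => []⟩ = _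
  simp only [reportAction, mem_inputWords, true_or, and_true]
  congr 1
  funext j
  congr 2
  funext v
  split_ifs with h
  · subst h
    exact report_congr localGraph_adj fun j => rfl
  · rfl

lemma run_one (i : Fin (M + 1)) :
    (sampling n M L).run G place ω 1 i = ⟨[], fun j => if i = 0 then
      (List.finRange n).flatMap fun v => if place v = j then report G (seedNumbers place ω) v else []
      else []⟩ := by
  change (⟨((sampling n M L).action G place ω 0 i).keep,
    fun j => ((sampling n M L).action G place ω 0 j).send i⟩ : Memory n (M + 1)) = _
  simp only [action_zero]

lemma action_one (i : Fin (M + 1)) :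
    (sampling n M L).action G place ω 1 i = ⟨[], fun j => if i = 0 then
      (List.finRange n).flatMap fun v => if place v = j then
        [(v.castSucc, (clusterLabel (outcome G place ω) v).castSucc)] else [] else []⟩ := by
  change answerAction L i ((sampling n M L).run G place ω 1 i) = _
  rw [run_one, answerAction]
  congr 1
  funext j
  by_cases hi : i = 0
  swap
  · simp [hi]
  simp only [hi, if_true]
  have hmsg : ∀ j (v : Fin n), (((List.finRange n).flatMap fun v =>
      if place v = j then report G (seedNumbers place ω) v else []).filter
        fun w => w.1 = v.castSucc) =
      if place v = j then report G (seedNumbers place ω) v else [] := fun j v =>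
    filter_flatMap_finRange (fun u w hw => by
      split_ifs at hw
      · exact fst_of_mem_report hw
      · simp at hw) v
  rw [decode_eq (G := G) (ω := seedNumbers place ω)]
  · congr 1
    funext v
    have hv : (∃ w ∈ (List.finRange n).flatMap fun v =>
        if place v = j then report G (seedNumbers place ω) v else [], w.1 = v.castSucc) ↔
          place v = j := by
      have h : (∃ w ∈ (List.finRange n).flatMap fun v =>
          if place v = j then report G (seedNumbers place ω) v else [], w.1 = v.castSucc) ↔
          ((List.finRange n).flatMap fun v =>
            if place v = j then report G (seedNumbers place ω) v else []).filter
            (fun w => w.1 = v.castSucc) ≠ [] := by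
        simp [List.filter_eq_nil_iff]
      rw [h, hmsg]
      split_ifs with h' <;> simp [h', report]
    simp only [hv]
    rfl
  · intro v
    rw [List.filter_flatMap]
    simp only [hmsg]
    simp only [eq_comm (a := place v)]
    exact flatMap_ite_eq _ (List.nodup_finRange _) (List.mem_finRange _)
      fun _ => report G (seedNumbers place ω) v

lemma run_two (i : Fin (M + 1)) :
    (sampling n M L).run G place ω 2 i = ⟨[], fun j => if j = 0 then
      (List.finRange n).flatMap fun v => if place v = i then
        [(v.castSucc, (clusterLabel (outcome G place ω) v).castSucc)] else [] else []⟩ := by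
  change (⟨((sampling n M L).action G place ω 1 i).keep,
    fun j => ((sampling n M L).action G place ω 1 j).send i⟩ : Memory n (M + 1)) = _
  simp only [action_one]

lemma clustering_sampling : (sampling n M L).clustering G place ω = outcome G place ω := by
  rw [← ker_clusterLabel (outcome G place ω), Algorithm.clustering]
  congr 1
  funext v
  rw [run_two]
  change toNode v (entry _ v 0) = _
  rw [entry]
  simp only [if_true]
  rw [filter_flatMap_finRange]
  · simp
  · intro u w hw
    split_ifs at hw
    · rw [List.mem_singleton.1 hw]
    · simp at hw

lemma usesSpace_sampling {S : ℕ} (hS : n * (L + 2) ≤ S) (hplace : Admissible S G place) :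
    (sampling n M L).UsesSpace S G place := by
  have hn : n ≤ S := by nlinarith
  have h1 : ∀ ω : (sampling n M L).Seeds, ∑ j, ((List.finRange n).flatMap fun v =>
      if place v = j then report G (seedNumbers place ω) v else []).length ≤ S := fun ω => by
    rw [sum_length_flatMap place fun _ v => report G (seedNumbers place ω) v]
    simpa [length_report] using hS
  have h2 : ∀ ω : (sampling n M L).Seeds, ∑ j, ((List.finRange n).flatMap fun v =>
      if place v = j then [((v.castSucc, (clusterLabel (outcome G place ω) v).castSucc) : Word n)]
        else []).length ≤ S := fun ω => by
    rw [sum_length_flatMap place fun _ v => [(v.castSucc, (clusterLabel _ v).castSucc)]]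
    simpa using hn
  refine fun ω => ⟨fun t ht i => ?_, fun t i => ?_⟩
  · interval_cases t
    · have := hplace i
      simp only [Algorithm.run, Memory.size, List.length_nil, sum_const_zero]
      omega
    · rw [run_one, Memory.size]
      by_cases hi : i = 0
      · simpa only [hi, if_true, List.length_nil, zero_add] using h1 ω
      · simp [hi]
    · rw [run_two, Memory.size]
      simp only [List.length_nil, zero_add]
      rw [sum_eq_single 0 (fun j _ hj => by simp [hj]) (by simp), if_pos rfl]
      exact (single_le_sum (f := fun j => ((List.finRange n).flatMap fun v =>
        if place v = j then [((v.castSucc, (clusterLabel (outcome G place ω) v).castSucc) : Word n)]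
          else []).length) (fun _ _ => Nat.zero_le _) (mem_univ i)).trans (h2 ω)
  · fin_cases t
    · change ((sampling n M L).action G place ω 0 i).sent ≤ S
      rw [action_zero, Action.sent]
      simp only
      rw [sum_eq_single 0 (fun j _ hj => by simp [hj]) (by simp), if_pos rfl]
      exact (single_le_sum (f := fun j => ((List.finRange n).flatMap fun v =>
        if place v = j then report G (seedNumbers place ω) v else []).length)
          (fun _ _ => Nat.zero_le _) (mem_univ i)).trans (h1 ω)
    · change ((sampling n M L).action G place ω 1 i).sent ≤ S
      rw [action_one, Action.sent]
      by_cases hi : i = 0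
      · simpa only [hi, if_true] using h2 ω
      · simp [hi]

end Gather

end MPC

namespace MPC

open Finset CorrClust FiniteProb

section Analysis

open Classical

variable {n M : ℕ}

/-- The seeds of all rounds and machines as one family of numbers. -/
noncomputable def seedsEquiv (n M L : ℕ) :
    (sampling n M L).Seeds ≃ (Fin 2 × Fin (M + 1) × (Fin n × Fin L) → Fin n.factorial) :=
  (Equiv.piCongrRight fun _ => (Equiv.piCongrRight fun _ => (seedEquiv n L).symm).trans
    (Equiv.curry _ _ _).symm).trans (Equiv.curry _ _ _).symm

lemma card_seedNumbers {L : ℕ} (place : Fin n → Fin (M + 1))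
    (E : (Fin n × Fin L → Fin n.factorial) → Prop) [DecidablePred E] :
    (univ.filter fun ω : (sampling n M L).Seeds => E (seedNumbers place ω)).card *
        Fintype.card (Fin n × Fin L → Fin n.factorial) =
      (univ.filter E).card * Fintype.card (sampling n M L).Seeds := by
  set idx : Fin n × Fin L → Fin 2 × Fin (M + 1) × (Fin n × Fin L) :=
    fun a => (0, place a.1, a) with hidx
  have hinj : Function.Injective idx := fun a b h => by
    simp only [hidx, Prod.mk.injEq] at h
    exact h.2.2
  rw [Fintype.card_congr (seedsEquiv n M L), ← card_comp_mul hinj E]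
  congr 1
  refine card_equiv (seedsEquiv n M L) fun ω => ?_
  simp only [mem_filter, mem_univ, true_and]
  rfl

lemma card_seeds_pos {T : ℕ} (A : Algorithm n M T) : (0 : ℝ) < Fintype.card A.Seeds := by
  have : Nonempty (Fin A.seeds) := ⟨⟨0, A.seeds_pos⟩⟩
  exact_mod_cast Fintype.card_pos

/-- The clustering is within a factor of two of the optimum, except with a small probability. -/
lemma card_two_mul_opt_lt_cost (c : ℕ) (hn : 2 ≤ n) (G : SimpleGraph (Fin n))
    (place : Fin n → Fin (M + 1)) :
    ((univ.filter fun ω : (sampling n M (numSamples c n)).Seeds =>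
      2 * opt G < cost G (outcome G place ω)).card : ℝ) ≤
      1 / (n : ℝ) ^ (c + 2) * Fintype.card (sampling n M (numSamples c n)).Seeds := by
  set L := numSamples c n
  set E : (Fin n × Fin L → Fin n.factorial) → Prop :=
    fun τ => ¬ GoodEstimate G (est L (deg G) (sample G τ)) with hE
  have hsub : (univ.filter fun ω : (sampling n M L).Seeds =>
      2 * opt G < cost G (outcome G place ω)) ⊆
        univ.filter fun ω : (sampling n M L).Seeds => E (seedNumbers place ω) := by
    refine monotone_filter_right univ fun ω _ h hgood => ?_
    exact absurd h (cost_choosePartition_le hgood _).not_gt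
  refine (Nat.cast_le.2 (card_le_card hsub)).trans ?_
  have h1 : ((univ.filter fun ω : (sampling n M L).Seeds => E (seedNumbers place ω)).card : ℝ) *
      Fintype.card (Fin n × Fin L → Fin n.factorial) =
        (univ.filter E).card * Fintype.card (sampling n M L).Seeds := by
    exact_mod_cast card_seedNumbers place E
  have h2 := card_not_goodEstimate_le c hn G
  have h3 : (0 : ℝ) < Fintype.card (Fin n × Fin L → Fin n.factorial) := by
    have : Nonempty (Fin n × Fin L → Fin n.factorial) := ⟨fun _ => ⟨0, n.factorial_pos⟩⟩
    exact_mod_cast Fintype.card_pos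
  refine le_of_mul_le_mul_right ?_ h3
  rw [h1]
  calc _ ≤ 1 / (n : ℝ) ^ (c + 2) * Fintype.card (Fin n × Fin L → Fin n.factorial) *
        Fintype.card (sampling n M L).Seeds := by gcongr
    _ = _ := by ring

lemma cost_outcome_eq_zero {L : ℕ} {G : SimpleGraph (Fin n)} (h : opt G = 0)
    (place : Fin n → Fin (M + 1)) (ω : (sampling n M L).Seeds) :
    cost G (outcome G place ω) = 0 :=
  cost_choosePartition_eq_zero h fun _ hP v =>
    est_nonpos_of_cost_eq_zero (sample_mem G (seedNumbers place ω)) hP v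

lemma expectation_cost_le (c : ℕ) (hn : 2 ≤ n) (G : SimpleGraph (Fin n))
    (place : Fin n → Fin (M + 1)) :
    (sampling n M (numSamples c n)).expectation (fun ω => (cost G (outcome G place ω) : ℝ)) ≤
      3 * opt G := by
  rw [Algorithm.expectation, div_le_iff₀ (card_seeds_pos _)]
  rcases Nat.eq_zero_or_pos (opt G) with h0 | h0
  · simp [cost_outcome_eq_zero h0, h0]
  have hn0 : (0 : ℝ) < n := by exact_mod_cast (by omega : 0 < n)
  have hn1 : (1 : ℝ) ≤ n := by exact_mod_cast (by omega : 1 ≤ n)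
  have hopt : (1 : ℝ) ≤ opt G := by exact_mod_cast h0
  set N : ℝ := (Fintype.card (sampling n M (numSamples c n)).Seeds : ℝ) with hN
  have hN0 : 0 < N := card_seeds_pos _
  have h1 : ∀ ω : (sampling n M (numSamples c n)).Seeds, (cost G (outcome G place ω) : ℝ) ≤
      2 * opt G + if 2 * opt G < cost G (outcome G place ω) then (n : ℝ) ^ 2 else 0 := by
    intro ω
    split_ifs with h
    · have : (cost G (outcome G place ω) : ℝ) ≤ (n : ℝ) ^ 2 := by exact_mod_cast cost_le G _
      linarith
    · rw [add_zero]; exact_mod_cast not_lt.1 h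
  refine (sum_le_sum fun ω _ => h1 ω).trans ?_
  rw [sum_add_distrib, sum_const, card_univ, nsmul_eq_mul, ← sum_filter, sum_const, nsmul_eq_mul,
    ← hN]
  have h2 := card_two_mul_opt_lt_cost (M := M) c hn G place
  rw [← hN] at h2
  have h3 : 1 / (n : ℝ) ^ (c + 2) * N * (n : ℝ) ^ 2 ≤ N := by
    have : (1 : ℝ) ≤ n ^ c := one_le_pow₀ hn1
    rw [pow_add]
    field_simp
    exact this
  have h4 := (mul_le_mul_of_nonneg_right h2 (sq_nonneg (n : ℝ))).trans h3
  nlinarith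

lemma one_sub_le_prob (c : ℕ) (hn : 2 ≤ n) (G : SimpleGraph (Fin n))
    (place : Fin n → Fin (M + 1)) :
    1 - 1 / (n : ℝ) ^ c ≤ (sampling n M (numSamples c n)).prob
      {ω | cost G (outcome G place ω) ≤ 2 * opt G} := by
  rw [Algorithm.prob, le_div_iff₀ (card_seeds_pos _)]
  set N : ℝ := (Fintype.card (sampling n M (numSamples c n)).Seeds : ℝ) with hN
  have hN0 : 0 < N := card_seeds_pos _
  have h1 : {ω : (sampling n M (numSamples c n)).Seeds |
      cost G (outcome G place ω) ≤ 2 * opt G}.ncard =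
        (univ.filter fun ω : (sampling n M (numSamples c n)).Seeds =>
          ¬ 2 * opt G < cost G (outcome G place ω)).card := by
    rw [← Set.ncard_coe_finset]
    congr 1
    ext ω
    simp
  have h2 := card_filter_add_card_filter_not (s := univ)
    fun ω : (sampling n M (numSamples c n)).Seeds => 2 * opt G < cost G (outcome G place ω)
  rw [← h1, card_univ] at h2
  have h3 := card_two_mul_opt_lt_cost (M := M) c hn G place
  rw [← hN] at h3
  have h4 : 1 / (n : ℝ) ^ (c + 2) * N ≤ 1 / (n : ℝ) ^ c * N := by
    have hn1 : (1 : ℝ) ≤ n := by exact_mod_cast (by omega : 1 ≤ n)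
    gcongr
    omega
  have h5 : ((univ.filter fun ω : (sampling n M (numSamples c n)).Seeds =>
      2 * opt G < cost G (outcome G place ω)).card : ℝ) +
        {ω : (sampling n M (numSamples c n)).Seeds |
          cost G (outcome G place ω) ≤ 2 * opt G}.ncard = N := by
    rw [hN]; exact_mod_cast h2
  linarith

end Analysis

lemma numClasses_le (n : ℕ) (hn : 2 ≤ n) : (numClasses n : ℝ) ≤ 3 * Real.log n := by
  have h1 : (Nat.log 2 n : ℝ) * Real.log 2 ≤ Real.log n := by
    rw [← Real.log_pow]
    refine Real.log_le_log (by positivity) ?_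
    exact_mod_cast Nat.pow_log_le_self 2 (by omega)
  have h2 := Real.log_two_gt_d9
  have h3 : (1 : ℝ) ≤ Nat.log 2 n := by
    exact_mod_cast Nat.log_pos (by norm_num) hn
  rw [numClasses]
  push_cast
  nlinarith

/-- The number of words reported to the first machine. -/
def reportSize (c n : ℕ) : ℕ := n * (numSamples c n + 2)

lemma reportSize_le (c n : ℕ) (hn : 2 ≤ n) :
    (4 * reportSize c n : ℝ) ≤ 4479192 * (c + 8) * n * Real.log n ^ 3 := by
  have h1 := numClasses_le n hn
  have h2 : (1 : ℝ) ≤ numClasses n := by exact_mod_cast Nat.succ_pos _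
  have h3 : (numClasses n : ℝ) ^ 3 ≤ 27 * Real.log n ^ 3 := by
    calc (numClasses n : ℝ) ^ 3 ≤ (3 * Real.log n) ^ 3 := by gcongr
      _ = _ := by ring
  have h4 : (1 : ℝ) ≤ numClasses n ^ 3 := one_le_pow₀ h2
  have hc : (0 : ℝ) ≤ c := Nat.cast_nonneg c
  have h5 : ((numSamples c n : ℝ) + 2) ≤ 41474 * (c + 8) * numClasses n ^ 3 := by
    rw [numSamples]
    push_cast
    nlinarith
  rw [reportSize]
  push_cast
  calc 4 * ((n : ℝ) * (numSamples c n + 2)) ≤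
        4 * (n * (41474 * (c + 8) * numClasses n ^ 3)) := by gcongr
    _ ≤ 4 * (n * (41474 * (c + 8) * (27 * Real.log n ^ 3))) := by gcongr
    _ = _ := by ring

end MPC

/-- The number of rounds `T` and the exponent `k` of the logarithm are absolute constants, and `C`
depends only on the exponent `c` of the failure probability `1 / n ^ c`. -/
theorem mainTheorem4 :
    ∃ T k : ℕ, ∀ c : ℕ, ∃ C : ℝ, 0 < C ∧
      ∀ ε : ℝ, 0 < ε → ε ≤ 1 → ∀ n m : ℕ, 2 ≤ n →
        ∃ (M S : ℕ) (A : MPC.Algorithm n M T),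
          (S : ℝ) ≤ C * (n / ε) * Real.log n ^ k ∧
          (M : ℝ) * S ≤ C * (m + n / ε) * Real.log n ^ k ∧
          ∀ G : SimpleGraph (Fin n), G.edgeSet.ncard = m →
            (∃ place : Fin n → Fin M, MPC.Admissible S G place) ∧
            ∀ place : Fin n → Fin M, MPC.Admissible S G place →
              A.UsesSpace S G place ∧
              A.expectation (fun ω => (CorrClust.cost G (A.clustering G place ω) : ℝ)) ≤
                (3 + ε) * CorrClust.opt G ∧
              1 - 1 / (n : ℝ) ^ c ≤
                A.prob {ω | (CorrClust.cost G (A.clustering G place ω) : ℝ) ≤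
                  (3 + ε) * CorrClust.opt G} := by
  refine ⟨2, 3, fun c => ⟨4479192 * (c + 8) + 216, by positivity, fun ε hε0 hε1 n m hn => ?_⟩⟩
  have hn0 : (0 : ℝ) < n := by exact_mod_cast (by omega : 0 < n)
  have hnε : (n : ℝ) ≤ n / ε := by
    rw [le_div_iff₀ hε0]; exact mul_le_of_le_one_right hn0.le hε1
  have hlog : (0 : ℝ) < Real.log n := Real.log_pos (by exact_mod_cast hn)
  set B := MPC.reportSize c n with hBdef
  have hB : n ≤ B := Nat.le_mul_of_pos_right n (by omega)
  have hB0 : 0 < B := by omega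
  have hS := MPC.reportSize_le c n hn
  rw [← hBdef] at hS
  refine ⟨(n + 2 * m) / B + 1, 4 * B, MPC.sampling n _ (CorrClust.numSamples c n), ?_, ?_, ?_⟩
  · push_cast
    refine hS.trans ?_
    gcongr
    linarith
  · have h1 : (((n + 2 * m) / B + 1 : ℕ) : ℝ) * (4 * B : ℕ) ≤ 4 * (n + 2 * m) + 4 * B := by
      have : ((n + 2 * m) / B + 1) * (4 * B) ≤ 4 * (n + 2 * m) + 4 * B := by
        have := Nat.div_mul_le_self (n + 2 * m) B
        nlinarith
      exact_mod_cast this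
    have h2 : (1 : ℝ) ≤ 27 * Real.log n ^ 3 := by
      have h3 := MPC.numClasses_le n hn
      have h4 : (1 : ℝ) ≤ CorrClust.numClasses n := by exact_mod_cast Nat.succ_pos _
      calc (1 : ℝ) ≤ (3 * Real.log n) ^ 3 := one_le_pow₀ (h4.trans h3)
        _ = _ := by ring
    have hm : (0 : ℝ) ≤ m := Nat.cast_nonneg m
    calc _ ≤ 4 * ((n : ℝ) + 2 * m) + 4 * B := h1
      _ ≤ 8 * ((m : ℝ) + n / ε) * 1 + 4479192 * (c + 8) * n * Real.log n ^ 3 := by linarith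
      _ ≤ 8 * ((m : ℝ) + n / ε) * (27 * Real.log n ^ 3) +
          4479192 * (c + 8) * (m + n / ε) * Real.log n ^ 3 := by
        gcongr
        linarith
      _ = _ := by ring
  · rintro G rfl
    refine ⟨MPC.exists_admissible G hB hB0, fun place hplace => ?_⟩
    simp only [MPC.clustering_sampling]
    have hopt : (0 : ℝ) ≤ CorrClust.opt G := Nat.cast_nonneg _
    refine ⟨MPC.usesSpace_sampling G place ?_ hplace, ?_, ?_⟩
    · exact Nat.le_mul_of_pos_left B (by norm_num)
    · refine (MPC.expectation_cost_le c hn G place).trans ?_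
      nlinarith
    · refine (MPC.one_sub_le_prob c hn G place).trans ?_
      refine div_le_div_of_nonneg_right ?_ (MPC.card_seeds_pos _).le
      refine Nat.cast_le.2 (Set.ncard_le_ncard (fun ω hω => ?_) (Set.toFinite _))
      have h : (CorrClust.cost G (MPC.outcome G place ω) : ℝ) ≤ 2 * CorrClust.opt G := by
        exact_mod_cast hω
      simp only [Set.mem_ofPred_eq]
      nlinarith
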